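/- All graphs are finite and simple. For $d\in\mathbb N=\{0,1,2,\dots\}$, the power $G^d$ of a graph $G$ is the graph on $V(G)$ in which two distinct vertices are adjacent iff their distance in $G$ is at most $d$; for a class $\mathcal C$ of graphs, $\mathcal C^d=\{G^d: G\in\mathcal C\}$, and the hereditary closure of a class consists of all graphs isomorphic to induced subgraphs of its members. A graph $M$ is a depth-$r$ minor of $G$ if $M$ can be obtained from a subgraph of $G$ by contracting pairwise disjoint connected subgraphs of radius at most $r$; $\nabla_r(G)$ is the maximum of $|E(M)|/|V(M)|$ over the depth-$r$ minors $M$ of $G$, and $\mathcal C$ has bounded expansion if $\sup_{G\in\mathcal C}\nabla_r(G)<\infty$ for every $r\in\mathbb N$. Write $\omega(H)$ for the maximum size of a clique in $H$. Theorem. Let $\mathcal C$ be a class of graphs of bounded expansion and let $d\in\mathbb N$. Then there exist a constant $s\in\mathbb N$, $s\ge 1$, and an $\mathcal O(nm)$-time algorithm that, given (by adjacency lists) a graph $H$ in the hereditary closure of $\mathcal C^d$ with $n$ vertices and $m$ edges, finds a clique in $H$ of size at least $\frac1s\cdot\omega(H)$. Here the algorithm is a program of a unit-cost random access machine (with numbers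 of $\mathcal O(\log n)$ bits), and $\mathcal O(nm)$ means that, for some constant $c$ depending only on $\mathcal C$ and $d$, it halts after at most $c\cdot\max(n,1)\cdot\max(m,1)$ steps, that is, at most $c\,nm$ steps whenever $H$ has an edge. -/

import Mathlib

open scoped ENNReal

universe u v w

/-! ### Graphs, powers, depth-`r` minors, bounded expansion -/

/-- A finite simple graph. A class of graphs is a term of type `Set FinGraph`. -/
structure FinGraph : Type (u + 1) where
  V : Type u
  finite : Finite V
  graph : SimpleGraph V

/-- The `d`th power: distinct vertices are adjacent iff their distance in `G` is at most `d`
(`edist` is `⊤` between different components). -/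
def graphPower {V : Type u} (G : SimpleGraph V) (d : ℕ) : SimpleGraph V where
  Adj x y := x ≠ y ∧ G.edist x y ≤ (d : ℕ∞)
  symm := ⟨fun x y h => ⟨h.1.symm, by rw [SimpleGraph.edist_comm]; exact h.2⟩⟩
  loopless := ⟨fun _ h => h.1 rfl⟩

/-- The class of `d`th powers of the graphs of `C`. -/
def powerClass (C : Set FinGraph.{u}) (d : ℕ) : Set FinGraph.{u} :=
  {P | ∃ G ∈ C, P = ⟨G.V, G.finite, graphPower G.graph d⟩}

/-- `H` is (isomorphic to) an induced subgraph of a graph of `C`. -/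
def InHereditaryClosure (C : Set FinGraph.{u}) {W : Type w} (H : SimpleGraph W) : Prop :=
  ∃ G ∈ C, Nonempty (H ↪g G.graph)

/-- `M` is a depth-`r` minor of `G`: there are pairwise disjoint branch sets in `G`, each inducing
a connected subgraph of radius at most `r` (every vertex is within distance `r` of some centre,
inside the branch set), such that adjacent vertices of `M` have branch sets joined by an edge
of `G`. -/
def IsDepthMinor (r : ℕ) {W : Type w} {V : Type v} (M : SimpleGraph W) (G : SimpleGraph V) :
    Prop :=
  ∃ B : W → Set V,
    (∀ x y, x ≠ y → Disjoint (B x) (B y)) ∧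
    (∀ x, ∃ c : B x, ∀ z : B x, (G.induce (B x)).edist c z ≤ (r : ℕ∞)) ∧
    (∀ x y, M.Adj x y → ∃ a ∈ B x, ∃ b ∈ B y, G.Adj a b)

/-- `∇_r(G)`: the largest edge density (number of edges divided by number of vertices) of a
depth-`r` minor of `G`. -/
noncomputable def nabla (r : ℕ) {V : Type v} (G : SimpleGraph V) : ℝ≥0∞ :=
  ⨆ (k : ℕ) (M : SimpleGraph (Fin k)) (_ : IsDepthMinor r M G),
    (M.edgeSet.ncard : ℝ≥0∞) / (k : ℝ≥0∞)

/-- `C` has bounded expansion: `∇_r(C) = sup_{G ∈ C} ∇_r(G)` is finite for every `r`. -/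
def BoundedExpansion (C : Set FinGraph.{u}) : Prop :=
  ∀ r : ℕ, (⨆ G ∈ C, nabla r G.graph) < ⊤

/-! ### Random access machine with unit-cost steps

A machine has registers and memory banks, all holding natural numbers; a program mentions only
finitely many registers and banks, and each bank is indirectly addressable through registers. The
only arithmetic is `+ 1` and `- 1`, so after `t` steps no number exceeds the largest initial
number or program constant by more than `t`; in particular, words of `O(log n)` bits suffice in
polynomial time, and the uniform cost measure is the usual one. -/

namespace RAM

structure State where
  reg : ℕ → ℕ
  mem : ℕ → ℕ → ℕ

/-- `reg i := x` -/
def State.setReg (σ : State) (i x : ℕ) : State :=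
  { σ with reg := Function.update σ.reg i x }

/-- `mem b a := x` -/
def State.setMem (σ : State) (b a x : ℕ) : State :=
  { σ with mem := Function.update σ.mem b (Function.update (σ.mem b) a x) }

/-- Tests between two registers. -/
inductive Cond where
  | lt (i j : ℕ)
  | eq (i j : ℕ)

def Cond.Holds : Cond → State → Prop
  | .lt i j, σ => σ.reg i < σ.reg j
  | .eq i j, σ => σ.reg i = σ.reg j

inductive Prog where
  | skip
  /-- `reg i := k` for a fixed number `k` -/
  | const (i k : ℕ)
  /-- `reg i := reg j` -/
  | copy (i j : ℕ)
  /-- `reg i := reg i + 1` -/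
  | inc (i : ℕ)
  /-- `reg i := reg i - 1`, where `0 - 1 = 0` -/
  | dec (i : ℕ)
  /-- `reg i := mem b (reg j)` -/
  | load (i b j : ℕ)
  /-- `mem b (reg i) := reg j` -/
  | store (b i j : ℕ)
  | seq (p q : Prog)
  | ite (c : Cond) (p q : Prog)
  | loop (c : Cond) (p : Prog)

/-- `Exec p σ t τ`: started in `σ`, the program `p` halts in state `τ` after `t` steps. Every
elementary instruction and every evaluation of a test is one step. -/
inductive Exec : Prog → State → ℕ → State → Prop where
  | skip (σ) : Exec .skip σ 1 σ
  | const (σ i k) : Exec (.const i k) σ 1 (σ.setReg i k)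
  | copy (σ i j) : Exec (.copy i j) σ 1 (σ.setReg i (σ.reg j))
  | inc (σ i) : Exec (.inc i) σ 1 (σ.setReg i (σ.reg i + 1))
  | dec (σ i) : Exec (.dec i) σ 1 (σ.setReg i (σ.reg i - 1))
  | load (σ i b j) : Exec (.load i b j) σ 1 (σ.setReg i (σ.mem b (σ.reg j)))
  | store (σ b i j) : Exec (.store b i j) σ 1 (σ.setMem b (σ.reg i) (σ.reg j))
  | seq {p q σ₁ σ₂ σ₃ t₁ t₂} (h₁ : Exec p σ₁ t₁ σ₂) (h₂ : Exec q σ₂ t₂ σ₃) :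
      Exec (.seq p q) σ₁ (t₁ + t₂) σ₃
  | ite_true {c p q σ τ t} (hc : c.Holds σ) (h : Exec p σ t τ) :
      Exec (.ite c p q) σ (1 + t) τ
  | ite_false {c p q σ τ t} (hc : ¬ c.Holds σ) (h : Exec q σ t τ) :
      Exec (.ite c p q) σ (1 + t) τ
  | loop_stop {c p σ} (hc : ¬ c.Holds σ) : Exec (.loop c p) σ 1 σ
  | loop_step {c p σ₁ σ₂ σ₃ t₁ t₂} (hc : c.Holds σ₁) (h₁ : Exec p σ₁ t₁ σ₂)
      (h₂ : Exec (.loop c p) σ₂ t₂ σ₃) : Exec (.loop c p) σ₁ (1 + t₁ + t₂) σ₃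

/-- The machine is deterministic: final state and number of steps are determined by the program
and the initial state. -/
theorem Exec.deterministic {p : Prog} {σ τ τ' : State} {t t' : ℕ} (h : Exec p σ t τ)
    (h' : Exec p σ t' τ') : t = t' ∧ τ = τ' := by
  induction h generalizing t' τ' with
  | skip | const | copy | inc | dec | load | store => cases h'; exact ⟨rfl, rfl⟩
  | seq _ _ ih₁ ih₂ =>
    cases h' with
    | seq k₁ k₂ =>
      obtain ⟨rfl, rfl⟩ := ih₁ k₁
      obtain ⟨rfl, rfl⟩ := ih₂ k₂
      exact ⟨rfl, rfl⟩
  | ite_true hc _ ih =>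
    cases h' with
    | ite_true _ k => obtain ⟨rfl, rfl⟩ := ih k; exact ⟨rfl, rfl⟩
    | ite_false hc' _ => exact absurd hc hc'
  | ite_false hc _ ih =>
    cases h' with
    | ite_true hc' _ => exact absurd hc' hc
    | ite_false _ k => obtain ⟨rfl, rfl⟩ := ih k; exact ⟨rfl, rfl⟩
  | loop_stop hc =>
    cases h' with
    | loop_stop _ => exact ⟨rfl, rfl⟩
    | loop_step hc' _ _ => exact absurd hc' hc
  | loop_step hc _ _ ih₁ ih₂ =>
    cases h' with
    | loop_stop hc' => exact absurd hc hc'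
    | loop_step _ k₁ k₂ =>
      obtain ⟨rfl, rfl⟩ := ih₁ k₁
      obtain ⟨rfl, rfl⟩ := ih₂ k₂
      exact ⟨rfl, rfl⟩

end RAM

/-! ### Input and output of graph algorithms -/

/-- `nbr` is an adjacency-list representation of `H`: `nbr v` lists the neighbours of `v`, each
once, in any order. -/
def IsAdjacencyList {n : ℕ} (H : SimpleGraph (Fin n)) (nbr : Fin n → List (Fin n)) : Prop :=
  ∀ x, (nbr x).Nodup ∧ ∀ y, y ∈ nbr x ↔ H.Adj x y

/-- The initial state for the graph with vertices `0, …, n - 1` and adjacency lists `nbr`.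
Register `0` holds `n`. Bank `1` holds the concatenation of the lists of `0, …, n - 1`. Cell `k ≤ n`
of bank `0` holds the total length of the lists of the vertices below `k`, so that the list of
vertex `k < n` occupies the cells of bank `1` from `mem 0 k` up to, but excluding, `mem 0 (k + 1)`.
All the other registers and cells are `0`. -/
def graphInput {n : ℕ} (nbr : Fin n → List (Fin n)) : RAM.State where
  reg i := if i = 0 then n else 0
  mem b k :=
    if b = 0 then
      if k ≤ n then (((List.finRange n).take k).map fun x => (nbr x).length).sum else 0
    else if b = 1 then (((List.finRange n).flatMap nbr).map Fin.val).getD k 0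
    else 0

/-- The final state `τ` presents the vertex set `K`: register `0` holds the size of `K`, and the
first cells of bank `2` list the elements of `K`, each once. -/
def OutputsVertexSet {n : ℕ} (τ : RAM.State) (K : Finset (Fin n)) : Prop :=
  (((List.range (τ.reg 0)).map (τ.mem 2) : List ℕ) : Multiset ℕ) = K.val.map Fin.val

section Hubs

variable {V : Type u} {G : SimpleGraph V}

/-- There is a walk of length at most `a` from `x` to `z` in `G` all of whose vertices `u`, except
possibly `z`, satisfy `z ∈ R u`. -/
def ClaimWalk (G : SimpleGraph V) (R : V → Finset V) : ℕ → V → V → Prop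
  | 0, x, z => x = z
  | a + 1, x, z => x = z ∨ (z ∈ R x ∧ ∃ y, G.Adj x y ∧ ClaimWalk G R a y z)

namespace ClaimWalk

theorem refl (R : V → Finset V) (a : ℕ) (z : V) : ClaimWalk G R a z z := by
  cases a with
  | zero => rfl
  | succ a => exact Or.inl rfl

theorem mono_claims {R R' : V → Finset V} (h : ∀ u, R u ⊆ R' u) {a : ℕ} {x z : V}
    (hw : ClaimWalk G R a x z) : ClaimWalk G R' a x z := by
  induction a generalizing x with
  | zero => exact hw
  | succ a ih =>
    rcases hw with rfl | ⟨h1, y, h2, h3⟩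
    · exact refl _ _ _
    · exact Or.inr ⟨h _ h1, y, h2, ih h3⟩

theorem mono_length {R : V → Finset V} {a b : ℕ} (hab : a ≤ b) {x z : V}
    (hw : ClaimWalk G R a x z) : ClaimWalk G R b x z := by
  induction a generalizing x b with
  | zero => rw [show x = z from hw]; exact refl _ _ _
  | succ a ih =>
    obtain ⟨b, rfl⟩ : ∃ b', b = b' + 1 := ⟨b - 1, by omega⟩
    rcases hw with rfl | ⟨h1, y, h2, h3⟩
    · exact refl _ _ _
    · exact Or.inr ⟨h1, y, h2, ih (by omega) h3⟩

theorem mem_claims {R : V → Finset V} (hR : ∀ u, u ∈ R u) {a : ℕ} {x z : V}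
    (hw : ClaimWalk G R a x z) : z ∈ R x := by
  cases a with
  | zero => rw [show x = z from hw]; exact hR _
  | succ a =>
    rcases hw with rfl | h
    · exact hR _
    · exact h.1

theorem edist_le {R : V → Finset V} {a : ℕ} {x z : V} (hw : ClaimWalk G R a x z) :
    G.edist x z ≤ a := by
  induction a generalizing x with
  | zero => rw [show x = z from hw]; simp
  | succ a ih =>
    rcases hw with rfl | ⟨_, y, h2, h3⟩
    · simp
    · calc G.edist x z ≤ G.edist x y + G.edist y z := SimpleGraph.edist_triangle
        _ ≤ 1 + a := by
          gcongr
          · exact (SimpleGraph.edist_eq_one_iff_adj.mpr h2).le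
          · exact ih h3
        _ = ((a + 1 : ℕ) : ℕ∞) := by push_cast; rw [add_comm]

/-- Walks can be concatenated when claims are passed on. -/
theorem trans {R R' : V → Finset V} {a b : ℕ} {x z y : V} (hw : ClaimWalk G R a x z)
    (hR : ∀ u, z ∈ R u → y ∈ R' u) (hw' : ClaimWalk G R' b z y) :
    ClaimWalk G R' (a + b) x y := by
  induction a generalizing x with
  | zero => rw [show x = z from hw, zero_add]; exact hw'
  | succ a ih =>
    rcases hw with rfl | ⟨h1, x', h2, h3⟩
    · exact hw'.mono_length (by omega)
    · rw [show a + 1 + b = (a + b) + 1 by omega]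
      exact Or.inr ⟨hR _ h1, x', h2, ih h3⟩

/-- A walk can be traversed backwards when claims are passed on. -/
theorem trans_reverse {R R' : V → Finset V} (hRR : ∀ u, u ∈ R u) {a b : ℕ} {x z y : V}
    (hw : ClaimWalk G R a x z) (hR : ∀ u, z ∈ R u → y ∈ R' u) (hw' : ClaimWalk G R' b x y) :
    ClaimWalk G R' (b + a) z y := by
  induction a generalizing x b with
  | zero => rw [← show x = z from hw, add_zero]; exact hw'
  | succ a ih =>
    rcases hw with rfl | ⟨h1, x', h2, h3⟩
    · exact hw'.mono_length (by omega)
    · have h4 : ClaimWalk G R' (b + 1) x' y :=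
        Or.inr ⟨hR _ (h3.mem_claims hRR), x, h2.symm, hw'⟩
      exact (ih h3 h4).mono_length (by omega)

/-- The vertices of a claim walk. -/
theorem exists_support [DecidableEq V] {R : V → Finset V} {a : ℕ} {x z : V}
    (hw : ClaimWalk G R a x z) :
    ∃ T : Finset V, T.card ≤ a + 1 ∧ z ∈ T ∧ (∀ u ∈ T, ClaimWalk G R a u z) ∧
      ∀ R' : V → Finset V, (∀ u ∈ T, z ∈ R' u) → ClaimWalk G R' a x z := by
  induction a generalizing x with
  | zero =>
    have hxz : x = z := hw
    subst hxz
    exact ⟨{x}, by simp, by simp, by simp [refl], fun _ _ => refl _ _ _⟩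
  | succ a ih =>
    rcases hw with rfl | ⟨h1, x', h2, h3⟩
    · exact ⟨{x}, by simp, by simp, by simp [refl], fun _ _ => refl _ _ _⟩
    · obtain ⟨T, hT, hz, hTR, hT'⟩ := ih h3
      refine ⟨insert x T, (Finset.card_insert_le _ _).trans (by omega), by simp [hz], ?_, ?_⟩
      · intro u hu
        rcases Finset.mem_insert.mp hu with rfl | hu
        · exact Or.inr ⟨h1, x', h2, h3⟩
        · exact (hTR u hu).mono_length (by omega)
      · intro R' hR'
        exact Or.inr ⟨hR' _ (by simp), x', h2, hT' R' fun u hu => hR' u (by simp [hu])⟩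

end ClaimWalk

/-- Every vertex claims itself and any two vertices at distance at most `d` have a common hub on a
walk of length at most `d` between them. -/
structure IsHubCover (G : SimpleGraph V) (R : V → Finset V) (d : ℕ) : Prop where
  self_mem : ∀ u, u ∈ R u
  exists_hub : ∀ x y, G.edist x y ≤ d →
    ∃ z a b, a + b ≤ d ∧ ClaimWalk G R a x z ∧ ClaimWalk G R b y z

/-- A relation whose number of pairs inside each finite set `A` is at most `k * #A` can be oriented
with out-degree at most `2 * k`. -/
theorem exists_orientation [Finite V] (r : V → V → Prop) (k : ℕ)
    (hr : ∀ A : Finset V, {p : V × V | p.1 ∈ A ∧ p.2 ∈ A ∧ r p.1 p.2}.ncard ≤ k * A.card) :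
    ∃ O : V → Finset V, (∀ u, (O u).card ≤ 2 * k) ∧ ∀ y z, r y z → z ∈ O y ∨ y ∈ O z := by
  classical
  have := Fintype.ofFinite V
  suffices h : ∀ A : Finset V, ∃ O : V → Finset V, (∀ u, (O u).card ≤ 2 * k) ∧
      ∀ y ∈ A, ∀ z ∈ A, r y z → z ∈ O y ∨ y ∈ O z by
    obtain ⟨O, h1, h2⟩ := h Finset.univ
    exact ⟨O, h1, fun y z => h2 y (Finset.mem_univ _) z (Finset.mem_univ _)⟩
  intro A
  induction A using Finset.strongInduction with
  | H A ih =>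
    rcases A.eq_empty_or_nonempty with rfl | hA
    · exact ⟨fun _ => ∅, by simp, by simp⟩
    obtain ⟨u, hu, hdeg⟩ : ∃ u ∈ A, (A.filter fun z => r u z ∨ r z u).card ≤ 2 * k := by
      by_contra! hcon
      have h1 : A.card * (2 * k + 1) ≤ ∑ u ∈ A, (A.filter fun z => r u z ∨ r z u).card := by
        simpa using Finset.card_nsmul_le_sum A _ (2 * k + 1) fun u hu => hcon u hu
      have h2 : ∑ u ∈ A, (A.filter fun z => r u z ∨ r z u).card ≤
          ∑ u ∈ A, (A.filter fun z => r u z).card + ∑ u ∈ A, (A.filter fun z => r z u).card := by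
        rw [← Finset.sum_add_distrib]
        refine Finset.sum_le_sum fun u _ => ?_
        rw [Finset.filter_or]
        exact Finset.card_union_le _ _
      have h3 : ∑ u ∈ A, (A.filter fun z => r u z).card =
          ((A ×ˢ A).filter fun p => r p.1 p.2).card := by
        simp only [Finset.card_filter, Finset.sum_product]
      have h4 : ∑ u ∈ A, (A.filter fun z => r z u).card =
          ((A ×ˢ A).filter fun p => r p.1 p.2).card := by
        simp only [Finset.card_filter, Finset.sum_product_right]
      have h5 : ((A ×ˢ A).filter fun p => r p.1 p.2).card ≤ k * A.card := by
        refine le_trans (le_of_eq ?_) (hr A)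
        rw [← Set.ncard_coe_finset]
        congr 1
        ext p
        simp [and_assoc]
      have hpos : 0 < A.card := hA.card_pos
      nlinarith
    obtain ⟨O, hO1, hO2⟩ := ih (A.erase u) (Finset.erase_ssubset hu)
    refine ⟨Function.update O u (A.filter fun z => r u z ∨ r z u), ?_, ?_⟩
    · intro x
      by_cases hx : x = u
      · subst hx; simpa using hdeg
      · simpa [hx] using hO1 x
    · intro y hy z hz hyz
      by_cases hyu : y = u
      · subst hyu; left; simp [hz, hyz]
      · by_cases hzu : z = u
        · subst hzu; right; simp [hy, hyz]
        · simpa [hyu, hzu] using hO2 y (by simp [hy, hyu]) z (by simp [hz, hzu]) hyz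

/-- The edge density of depth-`r` minors over arbitrary finite vertex types. -/
theorem ncard_edgeSet_le_of_isDepthMinor {W : Type w} [Fintype W] {r N : ℕ} {M : SimpleGraph W}
    (hM : IsDepthMinor r M G) (hN : nabla r G ≤ N) :
    M.edgeSet.ncard ≤ N * Fintype.card W := by
  obtain ⟨B, h1, h2, h3⟩ := hM
  let e := (Fintype.equivFin W).symm
  have hM' : IsDepthMinor r (M.comap e) G :=
    ⟨fun i => B (e i), fun x y hxy => h1 _ _ (by simpa using hxy), fun x => h2 _,
      fun x y hxy => h3 _ _ hxy⟩
  have hcard : (M.comap e).edgeSet.ncard = M.edgeSet.ncard :=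
    Nat.card_congr (SimpleGraph.Iso.comap e M).mapEdgeSet
  have h4 : ((M.comap e).edgeSet.ncard : ℝ≥0∞) / (Fintype.card W : ℝ≥0∞) ≤ N :=
    le_trans (le_iSup_of_le (Fintype.card W) (le_iSup_of_le (M.comap e)
      (le_iSup (fun _ : IsDepthMinor r (M.comap e) G =>
        ((M.comap e).edgeSet.ncard : ℝ≥0∞) / (Fintype.card W : ℝ≥0∞)) hM'))) hN
  rw [hcard] at h4
  rcases Nat.eq_zero_or_pos (Fintype.card W) with h0 | h0
  · have : IsEmpty W := Fintype.card_eq_zero_iff.mp h0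
    have : M.edgeSet = ∅ := by
      rw [SimpleGraph.edgeSet_eq_empty]; ext x; exact isEmptyElim x
    simp [this]
  · rw [ENNReal.div_le_iff (by positivity) (by simp)] at h4
    exact_mod_cast h4

/-- Choosing one claim for each vertex gives a shallow minor. -/
theorem card_realized_le [Fintype V] [DecidableEq V] {l N : ℕ} (hN : nabla l G ≤ N) (f : V → V)
    (A : Finset V) (P : Finset (V × V))
    (hP : ∀ p ∈ P, p.1 ∈ A ∧ p.2 ∈ A ∧ p.1 ≠ p.2 ∧ f p.1 = p.1 ∧ f p.2 = p.2 ∧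
      ∃ y, G.Adj p.1 y ∧ ClaimWalk G (fun u => {f u}) l y p.2) :
    P.card ≤ 2 * (N * A.card) := by
  classical
  let W := {x : V // x ∈ A ∧ f x = x}
  let rz : V → V → Prop := fun x z => ∃ y, G.Adj x y ∧ ClaimWalk G (fun u => {f u}) l y z
  let M : SimpleGraph W :=
    { Adj := fun x y => x ≠ y ∧ (rz x y ∨ rz y x)
      symm := ⟨fun x y h => ⟨h.1.symm, h.2.symm⟩⟩
      loopless := ⟨fun x h => h.1 rfl⟩ }
  have hself : ∀ (a : ℕ) (u : V) (x : W), ClaimWalk G (fun u => {f u}) a u x → f u = x := by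
    intro a u x h
    cases a with
    | zero => rw [show u = x from h]; exact x.2.2
    | succ a =>
      rcases h with rfl | h
      · exact x.2.2
      · exact (Finset.mem_singleton.mp h.1).symm
  have hM : IsDepthMinor l M G := by
    refine ⟨fun x => {u | ClaimWalk G (fun u => {f u}) l u x}, ?_, ?_, ?_⟩
    · intro x y hxy
      rw [Set.disjoint_left]
      intro u hx hy
      exact hxy (Subtype.ext ((hself _ _ _ hx).symm.trans (hself _ _ _ hy)))
    · intro x
      refine ⟨⟨x, ClaimWalk.refl _ _ _⟩, ?_⟩
      rintro ⟨z, hz⟩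
      have key : ∀ (a : ℕ) (hal : a ≤ l) (z : V) (hz : ClaimWalk G (fun u => {f u}) a z x),
          (G.induce {u | ClaimWalk G (fun u => {f u}) l u x}).edist
            ⟨x, ClaimWalk.refl _ _ _⟩ ⟨z, hz.mono_length hal⟩ ≤ a := by
        intro a
        induction a with
        | zero =>
          intro _ z hz
          have : z = x := hz
          subst this
          simp
        | succ a ih =>
          intro hal z hz
          have hz' := hz
          rcases hz' with h | ⟨_, y, h2, h3⟩
          · subst h; simp
          · refine SimpleGraph.edist_triangle (v := ⟨y, h3.mono_length (by omega)⟩) |>.trans ?_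
            push_cast
            gcongr
            · exact ih (by omega) y h3
            · refine (SimpleGraph.edist_eq_one_iff_adj.mpr ?_).le
              simpa using h2.symm
      exact key l le_rfl z hz
    · rintro x y ⟨_, ⟨w, h1, h2⟩ | ⟨w, h1, h2⟩⟩
      · exact ⟨x, ClaimWalk.refl _ _ _, w, h2, h1⟩
      · exact ⟨w, h2, y, ClaimWalk.refl _ _ _, h1.symm⟩
  have h1 := ncard_edgeSet_le_of_isDepthMinor hM hN
  have h2 : Fintype.card W ≤ A.card := by
    rw [Fintype.card_subtype]
    exact Finset.card_le_card fun x hx => by simp at hx; exact hx.1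
  have h3 : P.card ≤ Fintype.card M.Dart := by
    rw [← Fintype.card_coe]
    refine Fintype.card_le_of_injective (fun p : P =>
      (⟨(⟨p.1.1, (hP p p.2).1, (hP p p.2).2.2.2.1⟩, ⟨p.1.2, (hP p p.2).2.1, (hP p p.2).2.2.2.2.1⟩),
        ⟨fun h => (hP p p.2).2.2.1 (congrArg Subtype.val h),
          Or.inl (hP p p.2).2.2.2.2.2⟩⟩ : M.Dart)) ?_
    intro p q hpq
    simp only [SimpleGraph.Dart.mk.injEq, Prod.mk.injEq] at hpq
    exact Subtype.ext (Prod.ext (congrArg Subtype.val hpq.1) (congrArg Subtype.val hpq.2))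
  rw [SimpleGraph.dart_card_eq_twice_card_edges] at h3
  have h4 : M.edgeFinset.card = M.edgeSet.ncard := by
    rw [← SimpleGraph.coe_edgeFinset, Set.ncard_coe_finset]
  rw [h4] at h3
  calc P.card ≤ 2 * M.edgeSet.ncard := h3
    _ ≤ 2 * (N * A.card) := by gcongr; exact h1.trans (by gcongr)

theorem card_piFinset_le [Fintype V] [DecidableEq V] {R : V → Finset V} {K : ℕ}
    (hR : ∀ u, (R u).card ≤ K) (T : Finset V) (g : V → V) (hg : ∀ u ∈ T, g u ∈ R u) :
    (Fintype.piFinset R).card ≤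
      K ^ T.card * ((Fintype.piFinset R).filter fun f => ∀ u ∈ T, f u = g u).card := by
  have h1 : ((Fintype.piFinset R).filter fun f => ∀ u ∈ T, f u = g u) =
      Fintype.piFinset fun u => if u ∈ T then {g u} else R u := by
    ext f
    simp only [Finset.mem_filter, Fintype.mem_piFinset]
    constructor
    · rintro ⟨h1, h2⟩ u
      by_cases hu : u ∈ T
      · simp [hu, h2 u hu]
      · simp [hu, h1 u]
    · intro h
      refine ⟨fun u => ?_, fun u hu => by simpa [hu] using h u⟩
      by_cases hu : u ∈ T
      · have := h u
        simp only [hu, if_true, Finset.mem_singleton] at this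
        rw [this]; exact hg u hu
      · simpa [hu] using h u
  rw [h1, Fintype.card_piFinset, Fintype.card_piFinset, ← Finset.prod_mul_prod_compl T,
    ← Finset.prod_mul_prod_compl T (fun u => (if u ∈ T then {g u} else R u).card)]
  have h2 : ∏ u ∈ T, (if u ∈ T then {g u} else R u).card = 1 :=
    Finset.prod_eq_one fun u hu => by simp [hu]
  have h3 : ∏ u ∈ Tᶜ, (if u ∈ T then {g u} else R u).card = ∏ u ∈ Tᶜ, (R u).card :=
    Finset.prod_congr rfl fun u hu => by simp [Finset.mem_compl.mp hu]
  rw [h2, h3, one_mul]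
  gcongr
  exact Finset.prod_le_pow_card _ _ _ fun u _ => hR u

/-- The pairs that become connected by one further edge at the end of a claim walk are sparse. -/
theorem card_missing_le [Fintype V] [DecidableEq V] {R : V → Finset V} {K l N : ℕ}
    (hRR : ∀ u, u ∈ R u) (hR : ∀ u, (R u).card ≤ K) (hN : nabla l G ≤ N) (A : Finset V)
    (P : Finset (V × V)) (hP : ∀ p ∈ P, p.1 ∈ A ∧ p.2 ∈ A ∧ ¬ ClaimWalk G R l p.1 p.2 ∧
      ∃ y, G.Adj p.1 y ∧ ClaimWalk G R l y p.2) :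
    P.card ≤ 2 * N * K ^ (l + 2) * A.card := by
  classical
  rcases isEmpty_or_nonempty V with hV | ⟨⟨v₀⟩⟩
  · rw [Finset.eq_empty_of_isEmpty P]; simp
  have hK : 0 < K := (Finset.card_pos.mpr ⟨v₀, hRR v₀⟩).trans_le (hR v₀)
  let real : (V → V) → V × V → Prop := fun f p => f p.1 = p.1 ∧ f p.2 = p.2 ∧
    ∃ y, G.Adj p.1 y ∧ ClaimWalk G (fun u => {f u}) l y p.2
  set F := Fintype.piFinset R
  have hpos : 0 < F.card := Finset.card_pos.mpr ⟨id, Fintype.mem_piFinset.mpr hRR⟩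
  have h1 : ∀ p ∈ P, F.card ≤ K ^ (l + 2) * (F.filter fun f => real f p).card := by
    intro p hp
    obtain ⟨_, _, hno, y, hy, hw⟩ := hP p hp
    obtain ⟨T, hT, hz, hTR, hT'⟩ := hw.exists_support
    have hpT : p.1 ∉ T := fun h => hno (hTR _ h)
    let g : V → V := fun u => if u = p.1 then p.1 else p.2
    have hgT : ∀ u ∈ T, g u = p.2 := fun u hu =>
      if_neg fun h : u = p.1 => hpT (h ▸ hu)
    refine (card_piFinset_le hR (insert p.1 T) g ?_).trans ?_
    · intro u hu
      rcases Finset.mem_insert.mp hu with rfl | hu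
      · simpa [g] using hRR _
      · rw [hgT u hu]; exact (hTR u hu).mem_claims hRR
    · refine Nat.mul_le_mul (Nat.pow_le_pow_right hK
        ((Finset.card_insert_le _ _).trans (by omega))) (Finset.card_le_card ?_)
      intro f hf
      rw [Finset.mem_filter] at hf ⊢
      obtain ⟨hfF, hf⟩ := hf
      have h1 : f p.1 = p.1 := by simpa [g] using hf p.1 (by simp)
      have h2 : ∀ u ∈ T, f u = p.2 := fun u hu => by rw [hf u (by simp [hu]), hgT u hu]
      exact ⟨hfF, h1, h2 _ hz, y, hy, hT' _ fun u hu => by simp [h2 u hu]⟩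
  have h2 : ∀ f ∈ F, (P.filter fun p => real f p).card ≤ 2 * (N * A.card) := by
    intro f _
    refine card_realized_le hN f A _ fun p hp => ?_
    rw [Finset.mem_filter] at hp
    obtain ⟨hA1, hA2, hno, _⟩ := hP p hp.1
    refine ⟨hA1, hA2, fun h => hno ?_, hp.2⟩
    rw [h]; exact ClaimWalk.refl _ _ _
  have h3 : P.card * F.card ≤ K ^ (l + 2) * (F.card * (2 * (N * A.card))) := by
    calc P.card * F.card = ∑ p ∈ P, F.card := by simp
      _ ≤ ∑ p ∈ P, K ^ (l + 2) * (F.filter fun f => real f p).card := Finset.sum_le_sum h1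
      _ = K ^ (l + 2) * ∑ f ∈ F, (P.filter fun p => real f p).card := by
          rw [← Finset.mul_sum]
          congr 1
          simp only [Finset.card_filter]
          exact Finset.sum_comm
      _ ≤ K ^ (l + 2) * ∑ f ∈ F, 2 * (N * A.card) := by gcongr with f hf; exact h2 f hf
      _ = _ := by simp
  refine Nat.le_of_mul_le_mul_right (h3.trans (le_of_eq ?_)) hpos
  ring

/-- One more unit of distance. -/
theorem IsHubCover.exists_succ [Finite V] {R : V → Finset V} {K l N : ℕ} (h : IsHubCover G R l)
    (hR : ∀ u, (R u).card ≤ K) (hN : nabla l G ≤ N) :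
    ∃ R' : V → Finset V, IsHubCover G R' (l + 1) ∧
      ∀ u, (R' u).card ≤ (K + 2 * (2 * N * K ^ (l + 2))) ^ 2 := by
  classical
  have := Fintype.ofFinite V
  have hRR := h.self_mem
  obtain ⟨O, hO, hO'⟩ := exists_orientation
    (fun x z => ¬ ClaimWalk G R l x z ∧ ∃ y, G.Adj x y ∧ ClaimWalk G R l y z)
    (2 * N * K ^ (l + 2)) (by
      intro A
      rw [Set.ncard_eq_toFinset_card']
      exact card_missing_le hRR hR hN A _ fun p hp => by simpa using hp)
  let R₁ : V → Finset V := fun u => R u ∪ O u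
  let R₂ : V → Finset V := fun u => (R₁ u).biUnion R₁
  have hRR₁ : ∀ u, u ∈ R₁ u := fun u => Finset.mem_union_left _ (hRR u)
  have h01 : ∀ u, R u ⊆ R₁ u := fun u => Finset.subset_union_left
  have h12 : ∀ u, R₁ u ⊆ R₂ u := fun u x hx => Finset.mem_biUnion.mpr ⟨u, hRR₁ u, hx⟩
  have h02 : ∀ u, R u ⊆ R₂ u := fun u => (h01 u).trans (h12 u)
  have hcomp : ∀ u v w, v ∈ R₁ u → w ∈ R₁ v → w ∈ R₂ u := fun u v w h1 h2 =>
    Finset.mem_biUnion.mpr ⟨v, h1, h2⟩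
  have hcard₁ : ∀ u, (R₁ u).card ≤ K + 2 * (2 * N * K ^ (l + 2)) := fun u =>
    (Finset.card_union_le _ _).trans (add_le_add (hR u) (hO u))
  refine ⟨R₂, ⟨fun u => h02 u (hRR u), ?_⟩, ?_⟩
  · intro x y hxy
    obtain ⟨p, hp⟩ := SimpleGraph.exists_walk_of_edist_ne_top (G := G) (u := y) (v := x) (by
      rw [SimpleGraph.edist_comm]; exact ne_top_of_le_ne_top (ENat.natCast_ne_top _) hxy)
    rw [SimpleGraph.edist_comm, ← hp] at hxy
    have hlen : p.length ≤ l + 1 := by exact_mod_cast hxy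
    cases p with
    | nil => exact ⟨x, 0, 0, by omega, rfl, rfl⟩
    | @cons _ y' _ hadj p =>
      rw [SimpleGraph.Walk.length_cons] at hlen
      have hd : G.edist x y' ≤ l := by
        rw [SimpleGraph.edist_comm]
        exact (SimpleGraph.edist_le p).trans (by exact_mod_cast (by omega : p.length ≤ l))
      obtain ⟨z, a, b, hab, hx, hy'⟩ := h.exists_hub x y' hd
      by_cases hyz : z ∈ R y
      · exact ⟨z, a, b + 1, by omega, hx.mono_claims h02,
          Or.inr ⟨h02 _ hyz, y', hadj, hy'.mono_claims h02⟩⟩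
      rcases hO' y z ⟨fun hw => hyz (hw.mem_claims hRR), y', hadj, hy'.mono_length (by omega)⟩ with
        hz | hy
      · exact ⟨z, a, b + 1, by omega, hx.mono_claims h02,
          Or.inr ⟨h12 _ (Finset.mem_union_right _ hz), y', hadj, hy'.mono_claims h02⟩⟩
      · have hpass : ∀ u, z ∈ R u → y ∈ R₂ u := fun u hu =>
          hcomp u z y (h01 _ hu) (Finset.mem_union_right _ hy)
        have hzy : ClaimWalk G R₂ (1 + b) z y := hy'.trans_reverse hRR hpass
          (Or.inr ⟨hpass _ (hy'.mem_claims hRR), y, hadj.symm, rfl⟩)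
        exact ⟨y, a + (1 + b), 0, by omega, hx.trans hpass hzy, rfl⟩
  · intro u
    calc (R₂ u).card ≤ (R₁ u).card * (K + 2 * (2 * N * K ^ (l + 2))) :=
          Finset.card_biUnion_le_card_mul _ _ _ fun v _ => hcard₁ v
      _ ≤ _ := by rw [sq]; gcongr; exact hcard₁ u

theorem BoundedExpansion.exists_isHubCover {C : Set FinGraph.{u}} (hC : BoundedExpansion C)
    (d : ℕ) : ∃ K : ℕ, ∀ G ∈ C, ∃ R : G.V → Finset G.V,
      IsHubCover G.graph R d ∧ ∀ u, (R u).card ≤ K := by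
  induction d with
  | zero =>
    refine ⟨1, fun G _ => ⟨fun u => {u}, ⟨by simp, fun x y hxy => ⟨x, 0, 0, le_rfl, rfl, ?_⟩⟩,
      by simp⟩⟩
    exact (SimpleGraph.edist_eq_zero_iff.mp (nonpos_iff_eq_zero.mp hxy)).symm
  | succ l ih =>
    obtain ⟨K, hK⟩ := ih
    obtain ⟨N, hN⟩ := ENNReal.exists_nat_gt (hC l).ne
    refine ⟨(K + 2 * (2 * N * K ^ (l + 2))) ^ 2, fun G hG => ?_⟩
    obtain ⟨R, hR, hRK⟩ := hK G hG
    have := G.finite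
    exact hR.exists_succ hRK ((le_iSup₂_of_le G hG le_rfl).trans hN.le)

end Hubs

section CliqueStructure

variable {W : Type w}

open scoped Classical in
/-- The closed neighbourhood of `a` within `S`. -/
noncomputable def nbrIn (H : SimpleGraph W) (S : Finset W) (a : W) : Finset W :=
  S.filter fun x => a = x ∨ H.Adj a x

/-- The number of pairs of equal or adjacent vertices of `S`. -/
noncomputable def pairCount (H : SimpleGraph W) (S : Finset W) : ℕ :=
  ∑ a ∈ S, (nbrIn H S a).card

/-- Every vertex set contains a clique whose size is, up to the factor `k`, at least the average
size of a closed neighbourhood. -/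
def CliqueDense (H : SimpleGraph W) (k : ℕ) : Prop :=
  ∀ A : Finset W, ∃ Q ⊆ A, H.IsClique (Q : Set W) ∧ pairCount H A ≤ k * (Q.card * A.card)

/-- `L` lists, last pair first, a semi-ladder of `H`: `a ≠ b` are non-adjacent for each pair
`(a, b)`, and `a` is equal or adjacent to the second entry of each later pair. -/
def IsSemiLadder (H : SimpleGraph W) (L : List (W × W)) : Prop :=
  L.Pairwise (fun s t => t.1 = s.2 ∨ H.Adj t.1 s.2) ∧ ∀ s ∈ L, ¬ (s.1 = s.2 ∨ H.Adj s.1 s.2)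

theorem mem_nbrIn {H : SimpleGraph W} {S : Finset W} {a x : W} :
    x ∈ nbrIn H S a ↔ x ∈ S ∧ (a = x ∨ H.Adj a x) := by
  simp [nbrIn]

theorem nbrIn_subset {H : SimpleGraph W} {S : Finset W} {a : W} : nbrIn H S a ⊆ S :=
  fun _ hx => (mem_nbrIn.mp hx).1

theorem nbrIn_mono {H : SimpleGraph W} {S T : Finset W} (h : S ⊆ T) (a : W) :
    nbrIn H S a ⊆ nbrIn H T a := fun x hx => by
  rw [mem_nbrIn] at hx ⊢
  exact ⟨h hx.1, hx.2⟩

theorem pairCount_mono {H : SimpleGraph W} {S T : Finset W} (h : S ⊆ T) :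
    pairCount H S ≤ pairCount H T :=
  (Finset.sum_le_sum fun a _ => Finset.card_le_card (nbrIn_mono h a)).trans
    (Finset.sum_le_sum_of_subset h)

theorem pairCount_le (H : SimpleGraph W) (S : Finset W) : pairCount H S ≤ S.card * S.card := by
  simpa [pairCount] using Finset.sum_le_card_nsmul S _ S.card fun a _ => Finset.card_le_card nbrIn_subset

theorem subset_nbrIn_of_isClique {H : SimpleGraph W} {Q S : Finset W}
    (hQ : H.IsClique (Q : Set W)) (hQS : Q ⊆ S) {a : W} (ha : a ∈ Q) : Q ⊆ nbrIn H S a := by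
  intro x hx
  rw [mem_nbrIn]
  refine ⟨hQS hx, ?_⟩
  by_cases h : a = x
  · exact Or.inl h
  · exact Or.inr (hQ ha hx h)

theorem sq_card_le_pairCount {H : SimpleGraph W} {Q : Finset W} (hQ : H.IsClique (Q : Set W)) :
    Q.card * Q.card ≤ pairCount H Q := by
  simpa [pairCount] using Finset.card_nsmul_le_sum Q (fun a => (nbrIn H Q a).card) Q.card fun a ha =>
    Finset.card_le_card (subset_nbrIn_of_isClique hQ subset_rfl ha)

/-- In a dense part the smallest closed neighbourhood is bounded in terms of the cliques. -/
theorem CliqueDense.card_nbrIn_le {H : SimpleGraph W} {k ω : ℕ} (hH : CliqueDense H k)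
    (hω : ∀ Q : Finset W, H.IsClique (Q : Set W) → Q.card ≤ ω) {A : Finset W} {a : W} (ha : a ∈ A)
    (hmin : ∀ b ∈ A, (nbrIn H A a).card ≤ (nbrIn H A b).card) : (nbrIn H A a).card ≤ k * ω := by
  obtain ⟨Q, -, hQ, hQA⟩ := hH A
  have h1 : A.card * (nbrIn H A a).card ≤ pairCount H A := by
    simpa [pairCount] using Finset.card_nsmul_le_sum A (fun b => (nbrIn H A b).card) _ hmin
  have h2 : 0 < A.card := Finset.card_pos.mpr ⟨a, ha⟩
  refine Nat.le_of_mul_le_mul_left (h1.trans (hQA.trans ?_)) h2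
  calc k * (Q.card * A.card) ≤ k * (ω * A.card) := by gcongr; exact hω Q hQ
    _ = _ := by ring

/-! ### Refinement by neighbourhoods -/

/-- The loss of quality after a given number of refinements. -/
def refineLoss (k : ℕ) : ℕ → ℕ
  | 0 => 1
  | j + 1 => k ^ 4 * refineLoss k j ^ 2

theorem refineLoss_pos {k : ℕ} (hk : 0 < k) (j : ℕ) : 0 < refineLoss k j := by
  induction j with
  | zero => simp [refineLoss]
  | succ j ih => simp only [refineLoss]; positivity

theorem refineLoss_mono {k : ℕ} (hk : 0 < k) : Monotone (refineLoss k) := by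
  refine monotone_nat_of_le_succ fun j => ?_
  have := refineLoss_pos hk j
  calc refineLoss k j = 1 * refineLoss k j ^ 1 := by simp
    _ ≤ k ^ 4 * refineLoss k j ^ 2 := by
      gcongr
      · exact Nat.one_le_pow _ _ hk
      · norm_num

/-- The vertex set `S` arises by refinements along the semi-ladder `L` and still allows for a clique
of size comparable to `ω`. -/
structure IsRefinement (H : SimpleGraph W) (k ω : ℕ) (S : Finset W) (L : List (W × W)) : Prop where
  ladder : IsSemiLadder H L
  adj_of_mem : ∀ s ∈ L, ∀ x ∈ S, s.1 = x ∨ H.Adj s.1 x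
  card_le : S.card ≤ k * ω
  quality : (∃ Q ⊆ S, (∀ x ∈ Q, ∀ y ∈ S, x = y ∨ H.Adj x y) ∧
      ω ≤ k ^ 2 * refineLoss k L.length * Q.card) ∨
    ω * ω ≤ refineLoss k L.length * pairCount H S

theorem IsRefinement.step {H : SimpleGraph W} {k ω : ℕ} (hk : 0 < k) (hH : CliqueDense H k)
    {S : Finset W} {L : List (W × W)} (h : IsRefinement H k ω S L) {a b : W} (ha : a ∈ S)
    (hb : b ∈ S) (hab : ¬ (a = b ∨ H.Adj a b))
    (hmax : ∀ a' ∈ S, (∃ b' ∈ S, ¬ (a' = b' ∨ H.Adj a' b')) →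
      pairCount H (nbrIn H S a') ≤ pairCount H (nbrIn H S a)) :
    IsRefinement H k ω (nbrIn H S a) ((a, b) :: L) := by
  refine ⟨⟨List.pairwise_cons.mpr ⟨fun t ht => h.adj_of_mem t ht b hb, h.ladder.1⟩, ?_⟩, ?_,
    (Finset.card_le_card nbrIn_subset).trans h.card_le, ?_⟩
  · rintro s hs
    rcases List.mem_cons.mp hs with rfl | hs
    · exact hab
    · exact h.ladder.2 s hs
  · intro s hs x hx
    rw [mem_nbrIn] at hx
    rcases List.mem_cons.mp hs with rfl | hs
    · exact hx.2
    · exact h.adj_of_mem s hs x hx.1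
  have hkeep : ∀ Q ⊆ S, (∀ x ∈ Q, ∀ y ∈ S, x = y ∨ H.Adj x y) →
      ω ≤ k ^ 2 * refineLoss k L.length * Q.card →
      ∃ Q ⊆ nbrIn H S a, (∀ x ∈ Q, ∀ y ∈ nbrIn H S a, x = y ∨ H.Adj x y) ∧
        ω ≤ k ^ 2 * refineLoss k ((a, b) :: L).length * Q.card := by
    intro Q hQS hQ hω
    refine ⟨Q, fun x hx => mem_nbrIn.mpr ⟨hQS hx, ?_⟩, fun x hx y hy =>
      hQ x hx y (nbrIn_subset hy), hω.trans ?_⟩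
    · rcases hQ x hx a ha with h | h
      · exact Or.inl h.symm
      · exact Or.inr h.symm
    · gcongr
      exact refineLoss_mono hk (by simp)
  rcases h.quality with ⟨Q, hQS, hQ, hω⟩ | hω
  · exact Or.inl (hkeep Q hQS hQ hω)
  obtain ⟨Q, hQS, hQ, hcount⟩ := hH S
  have hω' : ω ≤ k ^ 2 * refineLoss k L.length * Q.card := by
    rcases Nat.eq_zero_or_pos ω with h0 | h0
    · omega
    refine Nat.le_of_mul_le_mul_right (hω.trans ?_) h0
    calc refineLoss k L.length * pairCount H S
        ≤ refineLoss k L.length * (k * (Q.card * (k * ω))) := by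
          gcongr
          exact hcount.trans (by gcongr; exact h.card_le)
      _ = _ := by ring
  by_cases hfull : ∀ x ∈ Q, ∀ y ∈ S, x = y ∨ H.Adj x y
  · exact Or.inl (hkeep Q hQS hfull hω')
  · push Not at hfull
    obtain ⟨a', ha', b', hb', hne, hnadj⟩ := hfull
    right
    have h1 : Q.card * Q.card ≤ pairCount H (nbrIn H S a) :=
      (sq_card_le_pairCount hQ).trans ((pairCount_mono (subset_nbrIn_of_isClique hQ hQS ha')).trans
        (hmax a' (hQS ha') ⟨b', hb', by tauto⟩))
    calc ω * ω ≤ (k ^ 2 * refineLoss k L.length * Q.card) *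
          (k ^ 2 * refineLoss k L.length * Q.card) := Nat.mul_le_mul hω' hω'
      _ = k ^ 4 * refineLoss k L.length ^ 2 * (Q.card * Q.card) := by ring
      _ ≤ _ := by rw [List.length_cons, refineLoss]; gcongr

theorem IsRefinement.le_card {H : SimpleGraph W} {k ω p : ℕ} (hk : 0 < k)
    {S : Finset W} {L : List (W × W)} (h : IsRefinement H k ω S L) (hp : L.length ≤ p) :
    ω ≤ k ^ 2 * refineLoss k p * S.card := by
  have hg := refineLoss_mono hk hp
  rcases h.quality with ⟨Q, hQS, -, hω⟩ | hω
  · refine hω.trans ?_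
    gcongr
  · have h1 : ω * ω ≤ (refineLoss k p * S.card) * (refineLoss k p * S.card) := by
      calc ω * ω ≤ refineLoss k p * 1 * (S.card * S.card) := by
            rw [mul_one]
            exact hω.trans (Nat.mul_le_mul hg (pairCount_le H S))
        _ ≤ refineLoss k p * refineLoss k p * (S.card * S.card) := by
            gcongr; exact refineLoss_pos hk p
        _ = _ := by ring
    calc ω ≤ 1 * (refineLoss k p * S.card) := by
          rw [one_mul]; exact Nat.mul_self_le_mul_self_iff.mp h1
      _ ≤ k ^ 2 * (refineLoss k p * S.card) := by
          gcongr; exact Nat.one_le_pow _ _ hk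
      _ = _ := by ring

/-! ### Powers of graphs with hub covers -/

/-- The bound on the length of a semi-ladder. -/
def ladderBound (k : ℕ) : ℕ → ℕ
  | 0 => 0
  | m + 1 => 1 + k * ladderBound k m

theorem List.length_le_sum_length_filter {α β : Type*} (L : List α) (O : Finset β)
    (r : α → β → Prop) [∀ b, DecidablePred fun a => r a b] (h : ∀ a ∈ L, ∃ b ∈ O, r a b) :
    L.length ≤ ∑ b ∈ O, (L.filter fun a => r a b).length := by
  induction L with
  | nil => simp
  | cons a L ih =>
    obtain ⟨b, hb, hab⟩ := h a (by simp)
    have h1 := ih fun a' ha' => h a' (by simp [ha'])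
    have h2 : ∑ b ∈ O, (L.filter fun a => r a b).length <
        ∑ b ∈ O, ((a :: L).filter fun a => r a b).length := by
      refine Finset.sum_lt_sum (fun b' _ => ?_) ⟨b, hb, ?_⟩
      · rw [List.filter_cons]; split <;> simp
      · simp [hab]
    rw [List.length_cons]
    omega

variable {V : Type u} {G : SimpleGraph V} {R : V → Finset V} {d K : ℕ}

theorem ClaimWalk.edist_le_of_common {a b : ℕ} {x y z : V} (hx : ClaimWalk G R a x z)
    (hy : ClaimWalk G R b y z) (hab : a + b ≤ d) : G.edist x y ≤ d := by
  calc G.edist x y ≤ G.edist x z + G.edist z y := SimpleGraph.edist_triangle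
    _ ≤ a + b := by rw [SimpleGraph.edist_comm (u := z)]; gcongr; exacts [hx.edist_le, hy.edist_le]
    _ ≤ d := by exact_mod_cast hab

theorem IsHubCover.length_ladder_le (h : IsHubCover G R d) (hR : ∀ u, (R u).card ≤ K) (m : ℕ)
    (L : List (V × V)) (Z : Finset (V × ℕ)) (hZ : K * (d + 1) + 1 ≤ Z.card + m)
    (hLZ : ∀ s ∈ L, ∀ o ∈ Z, o.2 ≤ d ∧ ClaimWalk G R o.2 s.2 o.1)
    (hL : L.Pairwise fun s t => G.edist s.1 t.2 ≤ d) (hL' : ∀ s ∈ L, ¬ G.edist s.1 s.2 ≤ d) :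
    L.length ≤ ladderBound (K * (d + 1)) m := by
  classical
  induction m generalizing L Z with
  | zero =>
    rcases L with _ | ⟨s, L⟩
    · simp
    · exfalso
      have h1 : Z ⊆ R s.2 ×ˢ Finset.range (d + 1) := fun o ho => by
        obtain ⟨h1, h2⟩ := hLZ s (by simp) o ho
        exact Finset.mem_product.mpr ⟨h2.mem_claims h.self_mem, Finset.mem_range.mpr (by omega)⟩
      have h2 := Finset.card_le_card h1
      rw [Finset.card_product, Finset.card_range] at h2
      have h3 := Nat.mul_le_mul_right (d + 1) (hR s.2)
      omega
  | succ m ih =>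
    rcases L with _ | ⟨s, L⟩
    · simp
    rw [List.pairwise_cons] at hL
    let O := (R s.1 ×ˢ Finset.range (d + 1)).filter fun o =>
      ∃ a, a + o.2 ≤ d ∧ ClaimWalk G R a s.1 o.1
    have hO : O.card ≤ K * (d + 1) := by
      refine (Finset.card_filter_le _ _).trans ?_
      rw [Finset.card_product, Finset.card_range]
      exact Nat.mul_le_mul_right _ (hR s.1)
    have h1 := List.length_le_sum_length_filter L O
      (fun t o => ClaimWalk G R o.2 t.2 o.1) (by
        intro t ht
        obtain ⟨z, a, b, hab, hx, hy⟩ := h.exists_hub _ _ (hL.1 t ht)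
        refine ⟨(z, b), Finset.mem_filter.mpr ⟨Finset.mem_product.mpr
          ⟨hx.mem_claims h.self_mem, Finset.mem_range.mpr (by simp; omega)⟩, a, hab, hx⟩, hy⟩)
    have h2 : ∀ o ∈ O, (L.filter fun t => ClaimWalk G R o.2 t.2 o.1).length ≤
        ladderBound (K * (d + 1)) m := by
      intro o ho
      obtain ⟨-, a, hao, ha⟩ := Finset.mem_filter.mp ho
      have hoZ : o ∉ Z := fun hoZ => hL' s (by simp)
        (ha.edist_le_of_common (hLZ s (by simp) o hoZ).2 hao)
      refine ih _ (insert o Z) (by rw [Finset.card_insert_of_notMem hoZ]; omega) ?_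
        (hL.2.sublist List.filter_sublist) fun t ht => hL' t (by simp [List.mem_of_mem_filter ht])
      intro t ht o' ho'
      rw [List.mem_filter] at ht
      rcases Finset.mem_insert.mp ho' with rfl | ho'
      · exact ⟨by omega, by simpa using ht.2⟩
      · exact hLZ t (by simp [ht.1]) o' ho'
    have h3 := Finset.sum_le_card_nsmul O _ _ h2
    rw [smul_eq_mul] at h3
    have h4 := Nat.mul_le_mul_right (ladderBound (K * (d + 1)) m) hO
    rw [List.length_cons, ladderBound]
    omega

variable {H : SimpleGraph W} {φ : W → V}

theorem IsHubCover.length_semiLadder_le (h : IsHubCover G R d) (hR : ∀ u, (R u).card ≤ K)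
    (hφ : ∀ x y, (x = y ∨ H.Adj x y) ↔ G.edist (φ x) (φ y) ≤ d) {L : List (W × W)}
    (hL : IsSemiLadder H L) : L.length ≤ ladderBound (K * (d + 1)) (K * (d + 1) + 1) := by
  have := h.length_ladder_le hR (K * (d + 1) + 1) (L.reverse.map (Prod.map φ φ)) ∅ (by simp)
    (by simp) (by
      rw [List.pairwise_map, List.pairwise_reverse]
      exact hL.1.imp fun {s t} hst => (hφ _ _).mp hst) (by
      intro s hs
      obtain ⟨t, ht, rfl⟩ := List.mem_map.mp hs
      exact fun hle => hL.2 t (List.mem_reverse.mp ht) ((hφ _ _).mpr hle))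
  simpa using this

theorem IsHubCover.cliqueDense [Finite V] (h : IsHubCover G R d) (hR : ∀ u, (R u).card ≤ K)
    (hφ : ∀ x y, (x = y ∨ H.Adj x y) ↔ G.edist (φ x) (φ y) ≤ d) : CliqueDense H (2 * K) := by
  classical
  have := Fintype.ofFinite V
  intro A
  rcases A.eq_empty_or_nonempty with rfl | ⟨a₀, ha₀⟩
  · exact ⟨∅, by simp, by simp, by simp [pairCount]⟩
  let near : V → Finset W := fun z => A.filter fun y => ClaimWalk G R (d / 2) (φ y) z
  obtain ⟨z₀, -, hz₀⟩ := Finset.exists_max_image Finset.univ (fun z => (near z).card)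
    ⟨φ a₀, Finset.mem_univ _⟩
  refine ⟨near z₀, Finset.filter_subset _ _, ?_, ?_⟩
  · intro x hx y hy hxy
    have hx' := (Finset.mem_filter.mp hx).2
    have hy' := (Finset.mem_filter.mp hy).2
    exact ((hφ x y).mpr (hx'.edist_le_of_common hy' (by omega))).resolve_left hxy
  let toward : W → Finset W := fun x => (R (φ x)).biUnion near
  have hto : ∀ x, (toward x).card ≤ K * (near z₀).card := fun x =>
    (Finset.card_biUnion_le_card_mul _ _ _ fun z _ => hz₀ z (Finset.mem_univ _)).trans
      (Nat.mul_le_mul_right _ (hR _))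
  have hsplit : ∀ x ∈ A, ∀ y ∈ A, (x = y ∨ H.Adj x y) → y ∈ toward x ∨ x ∈ toward y := by
    intro x hx y hy hxy
    obtain ⟨z, a, b, hab, hxz, hyz⟩ := h.exists_hub _ _ ((hφ x y).mp hxy)
    rcases le_or_gt b (d / 2) with hb | hb
    · exact Or.inl (Finset.mem_biUnion.mpr ⟨z, hxz.mem_claims h.self_mem,
        Finset.mem_filter.mpr ⟨hy, hyz.mono_length hb⟩⟩)
    · exact Or.inr (Finset.mem_biUnion.mpr ⟨z, hyz.mem_claims h.self_mem,
        Finset.mem_filter.mpr ⟨hx, hxz.mono_length (by omega)⟩⟩)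
  have hcount : pairCount H A ≤ ∑ x ∈ A, (toward x).card + ∑ x ∈ A, (toward x).card := by
    calc pairCount H A ≤ ∑ x ∈ A, ((A.filter fun y => y ∈ toward x).card +
          (A.filter fun y => x ∈ toward y).card) := by
          refine Finset.sum_le_sum fun x hx => ?_
          refine le_trans (Finset.card_le_card ?_) (Finset.card_union_le _ _)
          intro y hy
          rw [mem_nbrIn] at hy
          rw [← Finset.filter_or]
          exact Finset.mem_filter.mpr ⟨hy.1, hsplit x hx y hy.1 hy.2⟩
      _ = ∑ x ∈ A, (A.filter fun y => y ∈ toward x).card +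
          ∑ x ∈ A, (A.filter fun y => y ∈ toward x).card := by
          rw [Finset.sum_add_distrib]
          congr 1
          simp only [Finset.card_filter]
          exact Finset.sum_comm
      _ ≤ _ := by
          gcongr <;> exact fun y hy => (Finset.mem_filter.mp hy).2
  have hsum : ∑ x ∈ A, (toward x).card ≤ A.card * (K * (near z₀).card) := by
    simpa using Finset.sum_le_card_nsmul A _ _ fun x _ => hto x
  calc pairCount H A ≤ 2 * (A.card * (K * (near z₀).card)) := by omega
    _ = _ := by ring

theorem BoundedExpansion.exists_bounds {C : Set FinGraph.{u}} (hC : BoundedExpansion C) (d : ℕ) :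
    ∃ k p : ℕ, 0 < k ∧ ∀ (W : Type w) (H : SimpleGraph W),
      InHereditaryClosure (powerClass C d) H →
        CliqueDense H k ∧ ∀ L, IsSemiLadder H L → L.length ≤ p := by
  obtain ⟨K, hK⟩ := hC.exists_isHubCover d
  refine ⟨2 * (K + 1), ladderBound ((K + 1) * (d + 1)) ((K + 1) * (d + 1) + 1), by omega, ?_⟩
  rintro W H ⟨_, ⟨G, hG, rfl⟩, ⟨φ⟩⟩
  obtain ⟨R, hR, hRK⟩ := hK G hG
  have hRK' : ∀ u, (R u).card ≤ K + 1 := fun u => (hRK u).trans (Nat.le_succ _)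
  have := G.finite
  have hφ : ∀ x y, (x = y ∨ H.Adj x y) ↔ G.graph.edist (φ x) (φ y) ≤ d := by
    intro x y
    have h1 : H.Adj x y ↔ φ x ≠ φ y ∧ G.graph.edist (φ x) (φ y) ≤ d := φ.map_rel_iff.symm
    rw [h1]
    by_cases hxy : x = y
    · subst hxy; simp
    · simp [hxy, φ.injective.eq_iff]
  exact ⟨hR.cliqueDense hRK' hφ, fun L hL => hR.length_semiLadder_le hRK' hφ hL⟩

end CliqueStructure

namespace RAM

/-! ### Reasoning about programs -/

/-- Started in `σ`, the program `p` halts after at most `B` steps in a state satisfying `Q`. -/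
def Runs (p : Prog) (σ : State) (B : ℕ) (Q : State → Prop) : Prop :=
  ∃ t τ, Exec p σ t τ ∧ t ≤ B ∧ Q τ

instance (c : Cond) (σ : State) : Decidable (c.Holds σ) := by
  cases c <;> unfold Cond.Holds <;> infer_instance

@[simp] theorem Cond.holds_lt (i j : ℕ) (σ : State) :
    (Cond.lt i j).Holds σ ↔ σ.reg i < σ.reg j := Iff.rfl

@[simp] theorem Cond.holds_eq (i j : ℕ) (σ : State) :
    (Cond.eq i j).Holds σ ↔ σ.reg i = σ.reg j := Iff.rfl

@[simp] theorem State.setReg_reg (σ : State) (i x j : ℕ) :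
    (σ.setReg i x).reg j = if j = i then x else σ.reg j := by
  simp [State.setReg, Function.update_apply]

@[simp] theorem State.setReg_mem (σ : State) (i x : ℕ) : (σ.setReg i x).mem = σ.mem := rfl

@[simp] theorem State.setMem_reg (σ : State) (b a x : ℕ) : (σ.setMem b a x).reg = σ.reg := rfl

@[simp] theorem State.setMem_mem (σ : State) (b a x c : ℕ) :
    (σ.setMem b a x).mem c = if c = b then Function.update (σ.mem b) a x else σ.mem c := by
  by_cases h : c = b
  · subst h; simp [State.setMem]
  · simp [State.setMem, h]

def Prog.LoopFree : Prog → Prop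
  | .seq p q => p.LoopFree ∧ q.LoopFree
  | .ite _ p q => p.LoopFree ∧ q.LoopFree
  | .loop _ _ => False
  | _ => True

/-- The final state of a loop-free program. -/
def Prog.run : Prog → State → State
  | .skip, σ => σ
  | .const i k, σ => σ.setReg i k
  | .copy i j, σ => σ.setReg i (σ.reg j)
  | .inc i, σ => σ.setReg i (σ.reg i + 1)
  | .dec i, σ => σ.setReg i (σ.reg i - 1)
  | .load i b j, σ => σ.setReg i (σ.mem b (σ.reg j))
  | .store b i j, σ => σ.setMem b (σ.reg i) (σ.reg j)
  | .seq p q, σ => q.run (p.run σ)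
  | .ite c p q, σ => if c.Holds σ then p.run σ else q.run σ
  | .loop _ _, σ => σ

/-- A bound on the number of steps of a loop-free program. -/
def Prog.cost : Prog → ℕ
  | .seq p q => p.cost + q.cost
  | .ite _ p q => 1 + (p.cost + q.cost)
  | _ => 1

theorem Runs.mono {p : Prog} {σ : State} {B B' : ℕ} {Q Q' : State → Prop} (h : Runs p σ B Q)
    (hB : B ≤ B') (hQ : ∀ τ, Q τ → Q' τ) : Runs p σ B' Q' := by
  obtain ⟨t, τ, h1, h2, h3⟩ := h
  exact ⟨t, τ, h1, h2.trans hB, hQ τ h3⟩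

theorem Runs.seq {p q : Prog} {σ : State} {B B' : ℕ} {Q Q' : State → Prop} (h : Runs p σ B Q)
    (h' : ∀ τ, Q τ → Runs q τ B' Q') : Runs (.seq p q) σ (B + B') Q' := by
  obtain ⟨t, τ, h1, h2, h3⟩ := h
  obtain ⟨t', τ', h1', h2', h3'⟩ := h' τ h3
  exact ⟨t + t', τ', .seq h1 h1', by omega, h3'⟩

theorem Runs.ite {c : Cond} {p q : Prog} {σ : State} {B : ℕ} {Q : State → Prop}
    (h : c.Holds σ → Runs p σ B Q) (h' : ¬ c.Holds σ → Runs q σ B Q) :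
    Runs (.ite c p q) σ (1 + B) Q := by
  by_cases hc : c.Holds σ
  · obtain ⟨t, τ, h1, h2, h3⟩ := h hc
    exact ⟨1 + t, τ, .ite_true hc h1, by omega, h3⟩
  · obtain ⟨t, τ, h1, h2, h3⟩ := h' hc
    exact ⟨1 + t, τ, .ite_false hc h1, by omega, h3⟩

theorem Runs.of_loopFree {p : Prog} (hp : p.LoopFree) {σ : State} {Q : State → Prop}
    (h : Q (p.run σ)) : Runs p σ p.cost Q := by
  suffices h' : ∀ (p : Prog) (σ : State), p.LoopFree → Runs p σ p.cost fun τ => τ = p.run σ from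
    (h' p σ hp).mono le_rfl fun τ hτ => hτ ▸ h
  clear h hp
  intro p
  induction p with
  | skip => exact fun σ _ => ⟨1, _, .skip σ, le_rfl, rfl⟩
  | const i k => exact fun σ _ => ⟨1, _, .const σ i k, le_rfl, rfl⟩
  | copy i j => exact fun σ _ => ⟨1, _, .copy σ i j, le_rfl, rfl⟩
  | inc i => exact fun σ _ => ⟨1, _, .inc σ i, le_rfl, rfl⟩
  | dec i => exact fun σ _ => ⟨1, _, .dec σ i, le_rfl, rfl⟩
  | load i b j => exact fun σ _ => ⟨1, _, .load σ i b j, le_rfl, rfl⟩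
  | store b i j => exact fun σ _ => ⟨1, _, .store σ b i j, le_rfl, rfl⟩
  | seq p q ihp ihq =>
    intro σ hp
    exact (ihp σ hp.1).seq fun τ hτ => (ihq τ hp.2).mono le_rfl fun υ hυ => by
      rw [hυ, hτ, Prog.run]
  | ite c p q ihp ihq =>
    intro σ hp
    refine Runs.ite (fun hc => (ihp σ hp.1).mono (by omega) ?_)
      (fun hc => (ihq σ hp.2).mono (by omega) ?_)
    · rintro τ rfl; simp [Prog.run, hc]
    · rintro τ rfl; simp [Prog.run, hc]
  | loop c p => exact fun σ hp => hp.elim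

/-- Loops with a bound on the number of remaining rounds. -/
theorem Runs.loop {c : Cond} {p : Prog} {B : ℕ} {Q : State → Prop} (Inv : ℕ → State → Prop)
    (hbody : ∀ k σ, Inv k σ → c.Holds σ → ∃ k' < k, Runs p σ B (Inv k'))
    (hfinal : ∀ k σ, Inv k σ → ¬ c.Holds σ → Q σ) (k : ℕ) {σ : State} (hσ : Inv k σ) :
    Runs (.loop c p) σ (k * (B + 1) + 1) Q := by
  induction k using Nat.strong_induction_on generalizing σ with
  | _ k ih =>
    by_cases hc : c.Holds σ
    · obtain ⟨k', hk', t, τ, h1, h2, h3⟩ := hbody k σ hσ hc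
      obtain ⟨t', τ', h1', h2', h3'⟩ := ih k' hk' h3
      refine ⟨1 + t + t', τ', .loop_step hc h1 h1', ?_, h3'⟩
      have := Nat.mul_le_mul_right (B + 1) (Nat.succ_le_of_lt hk')
      rw [Nat.succ_mul] at this
      omega
    · exact ⟨1, σ, Exec.loop_stop hc, by omega, hfinal k σ hσ hc⟩

/-- Counting loop: the register `i` runs up to the value of register `j`. -/
def Prog.upTo (i j : ℕ) (p : Prog) : Prog := .loop (.lt i j) (.seq p (.inc i))

theorem Runs.upTo {i j : ℕ} {p : Prog} {Q : State → Prop} (Inv : ℕ → State → Prop) (T : ℕ → ℕ)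
    (lo hi : ℕ) (hlo : lo ≤ hi)
    (hbody : ∀ k, lo ≤ k → k < hi → ∀ σ, Inv k σ → σ.reg i = k → σ.reg j = hi →
      Runs p σ (T k) fun τ => τ.reg i = k ∧
        (τ.setReg i (k + 1)).reg j = hi ∧ Inv (k + 1) (τ.setReg i (k + 1)))
    (hfinal : ∀ σ, Inv hi σ → σ.reg i = hi → σ.reg j = hi → Q σ)
    {σ : State} (hσ : Inv lo σ) (hi' : σ.reg i = lo) (hj : σ.reg j = hi) :
    Runs (Prog.upTo i j p) σ (1 + ∑ k ∈ Finset.Ico lo hi, (T k + 2)) Q := by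
  induction hlen : hi - lo generalizing lo σ with
  | zero =>
    obtain rfl : lo = hi := by omega
    exact ⟨1, σ, Exec.loop_stop (by simp [hi', hj]), by omega, hfinal σ hσ hi' hj⟩
  | succ m ih =>
    have hlt : lo < hi := by omega
    obtain ⟨t, τ, h1, h2, h3, h4, h5⟩ := hbody lo le_rfl hlt σ hσ hi' hj
    obtain ⟨t', τ', h1', h2', h3'⟩ := ih (lo + 1) hlt
      (fun k hk => hbody k (by omega)) h5 (by simp) h4 (by omega)
    have hex := Exec.loop_step (c := .lt i j) (by simp [hi', hj, hlt]) (Exec.seq h1 (.inc τ i))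
      (by rw [h3]; exact h1')
    refine ⟨_, τ', hex, ?_, h3'⟩
    rw [Finset.sum_eq_sum_Ico_succ_bot hlt]
    omega

/-- The state `τ` differs from `σ` only in the registers `R` and the banks `B`. -/
structure Frame (R B : List ℕ) (σ τ : State) : Prop where
  reg : ∀ r, r ∉ R → τ.reg r = σ.reg r
  mem : ∀ b, b ∉ B → τ.mem b = σ.mem b

theorem Frame.refl (R B : List ℕ) (σ : State) : Frame R B σ σ := ⟨fun _ _ => rfl, fun _ _ => rfl⟩

theorem Frame.trans {R B : List ℕ} {σ τ υ : State} (h : Frame R B σ τ) (h' : Frame R B τ υ) :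
    Frame R B σ υ :=
  ⟨fun r hr => (h'.reg r hr).trans (h.reg r hr), fun b hb => (h'.mem b hb).trans (h.mem b hb)⟩

theorem Frame.mono {R B R' B' : List ℕ} {σ τ : State} (h : Frame R B σ τ) (hR : R ⊆ R')
    (hB : B ⊆ B') : Frame R' B' σ τ :=
  ⟨fun r hr => h.reg r fun h' => hr (hR h'), fun b hb => h.mem b fun h' => hb (hB h')⟩

theorem Frame.setReg {R B : List ℕ} {σ τ : State} (h : Frame R B σ τ) {i x : ℕ} (hi : i ∈ R) :
    Frame R B σ (τ.setReg i x) := by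
  refine ⟨fun r hr => ?_, h.mem⟩
  have : r ≠ i := fun h' => hr (h' ▸ hi)
  simp [this, h.reg r hr]

theorem Frame.setMem {R B : List ℕ} {σ τ : State} (h : Frame R B σ τ) {b a x : ℕ} (hb : b ∈ B) :
    Frame R B σ (τ.setMem b a x) := by
  refine ⟨h.reg, fun c hc => ?_⟩
  have : c ≠ b := fun h' => hc (h' ▸ hb)
  simp [this, h.mem c hc]

end RAM

/-! ### Graphs and vertex sets in memory -/

/-- Adjacency lists of `H`, stored consecutively in `adj` with offsets `off`. -/
structure IsAdjacencyArray {n : ℕ} (H : SimpleGraph (Fin n)) (off adj : ℕ → ℕ) : Prop where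
  off_zero : off 0 = 0
  off_mono : ∀ v < n, off v ≤ off (v + 1)
  adj_lt : ∀ v < n, ∀ i ∈ Finset.Ico (off v) (off (v + 1)), adj i < n
  adj_iff : ∀ v x : Fin n, H.Adj v x ↔ ∃ i ∈ Finset.Ico (off v) (off (v + 1)), adj i = x
  injOn : ∀ v < n, Set.InjOn adj (Finset.Ico (off v) (off (v + 1)))
  off_last : off n = 2 * H.edgeSet.ncard

namespace RAM

variable {n : ℕ}

/-- Bank `b` holds the characteristic function of `S`. -/
def HasSet (σ : State) (b : ℕ) (S : Finset (Fin n)) : Prop :=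
  ∀ v : Fin n, σ.mem b v = if v ∈ S then 1 else 0

/-- The parts of the state that the programs below do not change: the input graph and the constants
`1` and `0` in registers `1` and `2`. -/
structure HasGraph (n : ℕ) (off adj : ℕ → ℕ) (σ : State) : Prop where
  size : σ.reg 0 = n
  one : σ.reg 1 = 1
  zero : σ.reg 2 = 0
  off : σ.mem 0 = off
  adj : σ.mem 1 = adj

theorem HasGraph.frame {off adj : ℕ → ℕ} {σ τ : State} (h : HasGraph n off adj σ) {R B : List ℕ}
    (hf : Frame R B σ τ) (h0 : 0 ∉ R := by simp) (h1 : 1 ∉ R := by simp) (h2 : 2 ∉ R := by simp)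
    (h3 : 0 ∉ B := by simp) (h4 : 1 ∉ B := by simp) : HasGraph n off adj τ :=
  ⟨(hf.reg 0 h0).trans h.size, (hf.reg 1 h1).trans h.one, (hf.reg 2 h2).trans h.zero,
    (hf.mem 0 h3).trans h.off, (hf.mem 1 h4).trans h.adj⟩

theorem HasSet.frame {σ τ : State} {b : ℕ} {S : Finset (Fin n)} (h : HasSet σ b S) {R B : List ℕ}
    (hf : Frame R B σ τ) (hb : b ∉ B := by simp) : HasSet τ b S := fun v => by
  rw [hf.mem b hb]; exact h v

/-- The members of `S` below `k`. -/
def below (S : Finset (Fin n)) (k : ℕ) : Finset (Fin n) := S.filter fun x => x.val < k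

theorem below_zero (S : Finset (Fin n)) : below S 0 = ∅ := by simp [below]

theorem below_eq (S : Finset (Fin n)) : below S n = S := by simp [below]

theorem below_succ_of_mem {S : Finset (Fin n)} {k : ℕ} (hk : k < n) (h : (⟨k, hk⟩ : Fin n) ∈ S) :
    below S (k + 1) = Finset.cons ⟨k, hk⟩ (below S k) (by simp [below]) := by
  ext x
  simp only [below, Finset.mem_filter, Finset.mem_cons, Fin.ext_iff]
  constructor
  · rintro ⟨h1, h2⟩
    by_cases hx : x.val = k
    · exact Or.inl hx
    · exact Or.inr ⟨h1, by omega⟩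
  · rintro (h1 | h1)
    · exact ⟨(Fin.ext h1 : x = ⟨k, hk⟩) ▸ h, by omega⟩
    · exact ⟨h1.1, by omega⟩

theorem below_succ_of_notMem {S : Finset (Fin n)} {k : ℕ} (hk : k < n)
    (h : (⟨k, hk⟩ : Fin n) ∉ S) : below S (k + 1) = below S k := by
  ext x
  simp only [below, Finset.mem_filter]
  refine and_congr_right fun hx => ⟨fun h1 => ?_, fun h1 => by omega⟩
  have : x.val ≠ k := fun h2 => h ((Fin.ext h2 : x = ⟨k, hk⟩) ▸ hx)
  omega

end RAM

theorem graphInput_getD_flatMap {n : ℕ} (nbr : Fin n → List (Fin n)) (v : Fin n) (j : ℕ)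
    (hj : j < (nbr v).length) :
    (((List.finRange n).flatMap nbr).map Fin.val).getD
      ((((List.finRange n).take v).map fun x => (nbr x).length).sum + j) 0 = ((nbr v)[j] : ℕ) := by
  have h1 : List.finRange n = (List.finRange n).take v ++ v :: (List.finRange n).drop (v + 1) := by
    conv_lhs => rw [← List.take_append_drop v (List.finRange n)]
    rw [List.drop_eq_getElem_cons (by simp)]
    simp
  have h2 : (((List.finRange n).take v).map fun x => (nbr x).length).sum =
      (((List.finRange n).take v).flatMap nbr).length := by
    rw [List.length_flatMap]
  rw [h2]
  conv_lhs =>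
    enter [1]
    rw [h1]
  simp only [List.flatMap_append, List.flatMap_cons, List.map_append]
  rw [List.getD_append_right _ _ _ _ (by simp), List.getD_append _ _ _ _ (by simpa using hj)]
  simp [List.getElem?_eq_getElem hj]

theorem isAdjacencyArray_graphInput {n : ℕ} {H : SimpleGraph (Fin n)}
    {nbr : Fin n → List (Fin n)} (h : IsAdjacencyList H nbr) :
    IsAdjacencyArray H ((graphInput nbr).mem 0) ((graphInput nbr).mem 1) := by
  classical
  have hoff : ∀ k ≤ n, (graphInput nbr).mem 0 k =
      (((List.finRange n).take k).map fun x => (nbr x).length).sum := by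
    intro k hk; simp [graphInput, hk]
  have hsucc : ∀ v : Fin n, (graphInput nbr).mem 0 (v + 1) =
      (graphInput nbr).mem 0 v + (nbr v).length := by
    intro v
    rw [hoff _ v.2, hoff _ v.2.le, List.take_add_one]
    simp
  have hadj : ∀ v : Fin n, ∀ j (hj : j < (nbr v).length),
      (graphInput nbr).mem 1 ((graphInput nbr).mem 0 v + j) = ((nbr v)[j] : ℕ) := by
    intro v j hj
    rw [hoff _ v.2.le, ← graphInput_getD_flatMap nbr v j hj]
    rfl
  have hcell : ∀ v : Fin n, ∀ i ∈ Finset.Ico ((graphInput nbr).mem 0 v)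
      ((graphInput nbr).mem 0 (v + 1)), ∃ j, ∃ hj : j < (nbr v).length,
        i = (graphInput nbr).mem 0 v + j ∧ (graphInput nbr).mem 1 i = ((nbr v)[j] : ℕ) := by
    intro v i hi
    rw [Finset.mem_Ico, hsucc] at hi
    refine ⟨i - (graphInput nbr).mem 0 v, by omega, by omega, ?_⟩
    rw [← hadj v _ (by omega)]
    congr 1
    omega
  refine ⟨by simp [hoff], ?_, ?_, ?_, ?_, ?_⟩
  · intro v hv
    exact (hsucc ⟨v, hv⟩).symm ▸ Nat.le_add_right _ _
  · intro v hv i hi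
    obtain ⟨j, hj, -, h2⟩ := hcell ⟨v, hv⟩ i hi
    rw [h2]; exact Fin.is_lt _
  · intro v x
    rw [← (h v).2 x]
    constructor
    · intro hx
      obtain ⟨j, hj, rfl⟩ := List.getElem_of_mem hx
      exact ⟨_, by rw [Finset.mem_Ico, hsucc]; omega, hadj v j hj⟩
    · rintro ⟨i, hi, hix⟩
      obtain ⟨j, hj, -, h2⟩ := hcell v i hi
      rw [← show (nbr v)[j] = x from Fin.ext (h2.symm.trans hix)]
      exact List.getElem_mem _
  · intro v hv i hi i' hi' hii'
    obtain ⟨j, hj, h1, h2⟩ := hcell ⟨v, hv⟩ i hi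
    obtain ⟨j', hj', h1', h2'⟩ := hcell ⟨v, hv⟩ i' hi'
    have : j = j' := ((h ⟨v, hv⟩).1.getElem_inj_iff).mp (Fin.ext (h2.symm.trans (hii'.trans h2')))
    omega
  · rw [hoff n le_rfl, List.take_of_length_le (by simp)]
    have h1 : ∀ x, (nbr x).length = H.degree x := by
      intro x
      rw [← List.toFinset_card_of_nodup (h x).1, ← SimpleGraph.card_neighborFinset_eq_degree]
      congr 1
      ext y
      simp [(h x).2 y]
    have h2 : ((List.finRange n).map fun x => (nbr x).length).sum = ∑ x : Fin n, H.degree x := by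
      simp [h1, ← List.ofFn_eq_map, List.sum_ofFn]
    rw [h2, SimpleGraph.sum_degrees_eq_twice_card_edges, ← SimpleGraph.coe_edgeFinset,
      Set.ncard_coe_finset]

namespace IsAdjacencyArray

variable {n : ℕ} {H : SimpleGraph (Fin n)} {off adj : ℕ → ℕ}

theorem sum_degree (h : IsAdjacencyArray H off adj) :
    ∑ v ∈ Finset.Ico 0 n, (off (v + 1) - off v) = off n := by
  have key : ∀ k ≤ n, ∑ v ∈ Finset.range k, (off (v + 1) - off v) = off k := by
    intro k
    induction k with
    | zero => simp [h.off_zero]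
    | succ k ih =>
      intro hk
      rw [Finset.sum_range_succ, ih (by omega)]
      have := h.off_mono k hk
      omega
  rw [← key n le_rfl, Finset.range_eq_Ico]

theorem off_succ_le (h : IsAdjacencyArray H off adj) {v : ℕ} (hv : v < n) :
    off (v + 1) - off v ≤ off n := by
  rw [← h.sum_degree]
  exact Finset.single_le_sum (f := fun v => off (v + 1) - off v) (fun _ _ => Nat.zero_le _)
    (Finset.mem_Ico.mpr ⟨Nat.zero_le _, hv⟩)

/-- Cells of the list of `v` that hold members of `S` correspond to neighbours of `v` in `S`. -/
theorem card_cells (h : IsAdjacencyArray H off adj) {S : Finset (Fin n)} (v : Fin n) (hv : v ∈ S) :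
    ((Finset.Ico (off v) (off (v + 1))).filter fun i => ∃ x ∈ S, adj i = x.val).card + 1 =
      (nbrIn H S v).card := by
  classical
  have h1 : nbrIn H S v = insert v (S.filter fun x => H.Adj v x) := by
    ext x
    rw [mem_nbrIn, Finset.mem_insert, Finset.mem_filter]
    constructor
    · rintro ⟨h1, rfl | h2⟩
      · exact Or.inl rfl
      · exact Or.inr ⟨h1, h2⟩
    · rintro (rfl | h1)
      · exact ⟨hv, Or.inl rfl⟩
      · exact ⟨h1.1, Or.inr h1.2⟩
  rw [h1, Finset.card_insert_of_notMem (by simp)]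
  congr 1
  have h2 : (((Finset.Ico (off v) (off (v + 1))).filter fun i => ∃ x ∈ S, adj i = x.val).image
      adj) = (S.filter fun x => H.Adj v x).image Fin.val := by
    ext y
    simp only [Finset.mem_image, Finset.mem_filter]
    constructor
    · rintro ⟨i, ⟨hi, x, hx, hix⟩, rfl⟩
      exact ⟨x, ⟨hx, (h.adj_iff v x).mpr ⟨i, hi, hix⟩⟩, hix.symm⟩
    · rintro ⟨x, ⟨hx, hvx⟩, rfl⟩
      obtain ⟨i, hi, hix⟩ := (h.adj_iff v x).mp hvx
      exact ⟨i, ⟨hi, x, hx, hix⟩, hix⟩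
  rw [← Finset.card_image_of_injOn ((h.injOn v v.2).mono fun i hi => by
    simp only [Finset.coe_filter, Set.mem_ofPred_eq] at hi; exact hi.1), h2,
    Finset.card_image_of_injective _ Fin.val_injective]

end IsAdjacencyArray

namespace RAM

variable {n : ℕ} {H : SimpleGraph (Fin n)} {off adj : ℕ → ℕ}

/-! ### Subprograms -/

/-- Run `p` for each cell of the adjacency list of the vertex in register `v`; register `23` holds
the neighbour. -/
def forNbrs (v : ℕ) (p : Prog) : Prog :=
  .seq (.seq (.load 21 0 v) (.seq (.copy 22 v) (.seq (.inc 22) (.load 22 0 22))))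
    (.upTo 21 22 (.seq (.load 23 1 21) p))

theorem runs_forNbrs (h : IsAdjacencyArray H off adj) {v : ℕ} {a : Fin n} {p : Prog}
    (Inv : ℕ → State → Prop) (B : ℕ) (Q : State → Prop)
    (hbody : ∀ i ∈ Finset.Ico (off a) (off (a + 1)), ∀ σ, Inv i σ → σ.reg 21 = i →
      σ.reg 22 = off (a + 1) → σ.mem 1 = adj → Runs p (σ.setReg 23 (adj i)) B fun τ =>
        τ.reg 21 = i ∧ τ.reg 22 = off (a + 1) ∧ τ.mem 1 = adj ∧
          Inv (i + 1) (τ.setReg 21 (i + 1)))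
    (hfinal : ∀ σ, Inv (off (a + 1)) σ → Q σ)
    {σ : State} (hv : v ≠ 21) (hσ : σ.reg v = a) (h0 : σ.mem 0 = off) (h1 : σ.mem 1 = adj)
    (hInv : Inv (off a) ((σ.setReg 21 (off a)).setReg 22 (off (a + 1)))) :
    Runs (forNbrs v p) σ ((B + 3) * (off (a + 1) - off a) + 5) Q := by
  have hmono := h.off_mono a a.2
  refine Runs.mono (Runs.seq (Q := fun τ => τ = (σ.setReg 21 (off a)).setReg 22 (off (a + 1)))
    (Runs.of_loopFree ?_ ?_) fun τ hτ => ?_) (B := 4 + (1 + ∑ k ∈ Finset.Ico (off a) (off (a + 1)),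
      ((fun _ => 1 + B) k + 2))) ?_ fun _ hQ => hQ
  · simp [Prog.LoopFree]
  · simp only [Prog.run, State.setReg, State.mk.injEq, and_true]
    funext r
    by_cases h22 : r = 22 <;> simp [Function.update_apply, hσ, h0, hv, h22]
  · subst hτ
    refine Runs.upTo (fun i σ => Inv i σ ∧ σ.mem 1 = adj) (fun _ => 1 + B) (off a) (off (a + 1))
      hmono ?_ (fun σ hσ _ _ => hfinal σ hσ.1) ⟨hInv, by simp [h1]⟩ (by simp) (by simp)
    rintro i hi1 hi2 σ ⟨hσ1, hσ2⟩ hi hj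
    refine Runs.seq (Q := fun τ => τ = σ.setReg 23 (adj i))
      (Runs.of_loopFree (p := .load 23 1 21) trivial ?_) fun τ hτ => ?_
    · simp [Prog.run, hi, hσ2]
    · subst hτ
      refine (hbody i (Finset.mem_Ico.mpr ⟨hi1, hi2⟩) σ hσ1 hi hj hσ2).mono le_rfl ?_
      rintro τ ⟨h1, h2, h3, h4⟩
      exact ⟨h1, by simp [h2], h4, by simp [h3]⟩
  · simp only [Finset.sum_const, Nat.card_Ico, smul_eq_mul]
    have : (off (a + 1) - off a) * (1 + B + 2) = (B + 3) * (off (a + 1) - off a) := by ring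
    omega

theorem HasSet.mem_iff {σ : State} {b : ℕ} {S : Finset (Fin n)} (h : HasSet σ b S) {k : ℕ}
    (hk : k < n) : σ.mem b k = 1 ↔ ∃ x ∈ S, k = x.val := by
  have := h ⟨k, hk⟩
  simp only at this
  rw [this]
  constructor
  · intro h1
    by_cases h2 : (⟨k, hk⟩ : Fin n) ∈ S
    · exact ⟨_, h2, rfl⟩
    · simp [h2] at h1
  · rintro ⟨x, hx, rfl⟩
    simp [hx]

/-- Add to register `25` the number of neighbours of the vertex in register `20` in the set in
bank `b`. -/
def addNbrs (b : ℕ) : Prog :=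
  forNbrs 20 (.seq (.load 24 b 23) (.ite (.eq 24 1) (.inc 25) .skip))

theorem runs_addNbrs (h : IsAdjacencyArray H off adj) {b : ℕ} {S : Finset (Fin n)} {σ : State}
    (hG : HasGraph n off adj σ) (hS : HasSet σ b S) {a : Fin n} (ha : σ.reg 20 = a)
    (haS : a ∈ S) :
    Runs (addNbrs b) σ (7 * (off (a + 1) - off a) + 5) fun τ =>
      Frame [21, 22, 23, 24, 25] [] σ τ ∧ τ.reg 25 + 1 = σ.reg 25 + (nbrIn H S a).card := by
  classical
  refine runs_forNbrs h (fun i τ => Frame [21, 22, 23, 24, 25] [] σ τ ∧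
    τ.reg 25 = σ.reg 25 +
      ((Finset.Ico (off a) i).filter fun i => ∃ x ∈ S, adj i = x.val).card) 4 _ ?_ ?_ (by simp) ha
    hG.off hG.adj ⟨((Frame.refl _ _ _).setReg (by simp)).setReg (by simp), by simp⟩
  · rintro i hi τ ⟨hF, hc⟩ h21 h22 hadj
    have hlt := h.adj_lt a a.2 i hi
    have hmem := hS.mem_iff hlt
    have hb := hF.mem b (by simp)
    have h1 := (hG.frame hF).one
    have hIco : Finset.Ico (off a) (i + 1) = insert i (Finset.Ico (off a) i) := by
      rw [Finset.insert_Ico_right_eq_Ico_add_one (Finset.mem_Ico.mp hi).1]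
    have hni : i ∉ (Finset.Ico (off a) i).filter fun i => ∃ x ∈ S, adj i = x.val := by simp
    refine Runs.of_loopFree (p := .seq (.load 24 b 23) (.ite (.eq 24 1) (.inc 25) .skip))
      (by simp [Prog.LoopFree]) ?_
    by_cases hin : ∃ x ∈ S, adj i = x.val
    · have h2 : σ.mem b (adj i) = 1 := hmem.mpr hin
      simp only [Prog.run, Cond.holds_eq, State.setReg_reg, State.setReg_mem, hb, if_true, h1]
      simp only [show (1 : ℕ) ≠ 23 by norm_num, show (1 : ℕ) ≠ 24 by norm_num, h2, if_true,
        if_false]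
      refine ⟨by simp [h21], by simp [h22], by simp [hadj], ?_, ?_⟩
      · exact (((hF.setReg (by simp)).setReg (by simp)).setReg (by simp)).setReg (by simp)
      · rw [hIco, Finset.filter_insert, if_pos hin, Finset.card_insert_of_notMem hni]
        simp [hc, add_assoc]
    · have h2 : σ.mem b (adj i) ≠ 1 := fun h => hin (hmem.mp h)
      simp only [Prog.run, Cond.holds_eq, State.setReg_reg, State.setReg_mem, hb, if_true, h1]
      simp only [show (1 : ℕ) ≠ 23 by norm_num, show (1 : ℕ) ≠ 24 by norm_num, h2, if_false]
      refine ⟨by simp [h21], by simp [h22], by simp [hadj], ?_, ?_⟩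
      · exact ((hF.setReg (by simp)).setReg (by simp)).setReg (by simp)
      · rw [hIco, Finset.filter_insert, if_neg hin]
        simp [hc]
  · rintro τ ⟨hF, hc⟩
    refine ⟨hF, ?_⟩
    rw [hc, ← h.card_cells a haS]
    omega

end RAM

namespace RAM

variable {n : ℕ} {H : SimpleGraph (Fin n)} {off adj : ℕ → ℕ}

/-- Run `p` for each vertex, held in register `i`. -/
def forVerts (i : ℕ) (p : Prog) : Prog := .seq (.const i 0) (.upTo i 0 p)

theorem runs_forVerts {i : ℕ} {p : Prog} {Q : State → Prop} (Inv : ℕ → State → Prop) (T : ℕ → ℕ)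
    (hbody : ∀ k, k < n → ∀ σ, Inv k σ → σ.reg i = k →
      Runs p σ (T k) fun τ => τ.reg i = k ∧ Inv (k + 1) (τ.setReg i (k + 1)))
    (hsize : ∀ k σ, Inv k σ → σ.reg 0 = n)
    (hfinal : ∀ σ, Inv n σ → Q σ) {σ : State} (hσ : Inv 0 (σ.setReg i 0)) :
    Runs (forVerts i p) σ (2 + ∑ k ∈ Finset.Ico 0 n, (T k + 2)) Q := by
  refine Runs.mono (Runs.seq (Q := fun τ => τ = σ.setReg i 0)
    (Runs.of_loopFree (p := .const i 0) trivial rfl) fun τ hτ => ?_)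
    (B := 1 + (1 + ∑ k ∈ Finset.Ico 0 n, (T k + 2))) (by omega) fun _ h => h
  subst hτ
  refine Runs.upTo Inv T 0 n (Nat.zero_le _) ?_ (fun σ h _ _ => hfinal σ h) hσ (by simp)
    (hsize _ _ hσ)
  intro k _ hk σ hσ hi _
  exact (hbody k hk σ hσ hi).mono le_rfl fun τ hτ => ⟨hτ.1, hsize _ _ hτ.2, hτ.2⟩

theorem HasSet.eq_one {σ : State} {b : ℕ} {S : Finset (Fin n)} (h : HasSet σ b S) {k : ℕ}
    {hk : k < n} (hmem : (⟨k, hk⟩ : Fin n) ∈ S) : σ.mem b k = 1 := by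
  simpa [hmem] using h ⟨k, hk⟩

theorem HasSet.eq_zero {σ : State} {b : ℕ} {S : Finset (Fin n)} (h : HasSet σ b S) {k : ℕ}
    {hk : k < n} (hmem : (⟨k, hk⟩ : Fin n) ∉ S) : σ.mem b k = 0 := by
  simpa [hmem] using h ⟨k, hk⟩

/-- Run `p` for each member of the set in bank `b`, held in register `i`. -/
def forMembers (b i : ℕ) (p : Prog) : Prog :=
  forVerts i (.seq (.load 13 b i) (.ite (.eq 13 1) p .skip))

theorem runs_forMembers {b i : ℕ} {p : Prog} {Q : State → Prop} (S : Finset (Fin n))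
    (Inv : Finset (Fin n) → State → Prop) (T : ℕ → ℕ) (hi : i ≠ 13)
    (hbody : ∀ (a : Fin n) (ha : a ∉ below S a), a ∈ S → ∀ σ, Inv (below S a) σ → σ.reg i = a →
      Runs p σ (T a) fun τ => τ.reg i = a ∧ Inv (Finset.cons a (below S a) ha) τ)
    (hinv : ∀ A σ, Inv A σ → σ.reg 0 = n ∧ σ.reg 1 = 1 ∧ HasSet σ b S)
    (hreg : ∀ A σ x, Inv A σ → Inv A (σ.setReg i x) ∧ Inv A (σ.setReg 13 x))
    (hfinal : ∀ σ, Inv S σ → Q σ) {σ : State} (hσ : Inv ∅ σ) (B : ℕ)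
    (hB : ∑ a ∈ S, T a + 5 * n + 2 ≤ B) :
    Runs (forMembers b i p) σ B Q := by
  classical
  let T' : ℕ → ℕ := fun k => 3 + if h : k < n then (if (⟨k, h⟩ : Fin n) ∈ S then T k else 0) else 0
  refine Runs.mono (runs_forVerts (fun k σ => Inv (below S k) σ) T' ?_ (fun k σ h => (hinv _ _ h).1)
    (fun σ h => hfinal σ (by rwa [below_eq] at h)) (by rw [below_zero]; exact (hreg _ _ _ hσ).1))
    (le_trans ?_ hB) fun _ h => h
  · intro k hk σ hσ hik
    obtain ⟨-, h1, hS⟩ := hinv _ _ hσ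
    refine Runs.mono (Runs.seq (Q := fun τ => τ = σ.setReg 13 (σ.mem b k))
      (Runs.of_loopFree (p := .load 13 b i) trivial (by simp [Prog.run, hik])) fun τ hτ =>
        (Runs.ite (B := T' k - 2) (fun hc => ?_) (fun hc => ?_)))
      (B := 1 + (1 + (T' k - 2))) (by simp only [T']; omega) fun _ h => h
    · subst hτ
      by_cases hmem : (⟨k, hk⟩ : Fin n) ∈ S
      · refine (hbody ⟨k, hk⟩ (by simp [below]) hmem _ (hreg _ _ _ hσ).2
          (by simp [hik, hi])).mono ?_ ?_
        · simp only [T', hk, hmem, dif_pos, if_true]; omega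
        · rintro τ ⟨h2, h3⟩
          refine ⟨h2, (hreg _ _ _ ?_).1⟩
          rw [below_succ_of_mem hk hmem]
          exact h3
      · simp [h1, hS.eq_zero hmem] at hc
    · subst hτ
      have hmem : (⟨k, hk⟩ : Fin n) ∉ S := fun hmem => hc (by simp [h1, hS.eq_one hmem])
      refine Runs.mono (Runs.of_loopFree (p := .skip) trivial ?_) (by
        simp only [Prog.cost, T']; omega) fun _ h => h
      refine ⟨by simp [Prog.run, hik, hi], ?_⟩
      rw [below_succ_of_notMem hk hmem]
      exact (hreg _ _ _ (hreg _ _ _ hσ).2).1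
  · have h1 : ∑ k ∈ Finset.Ico 0 n, (T' k + 2) =
        5 * n + ∑ a : Fin n, if a ∈ S then T a else 0 := by
      rw [← Finset.range_eq_Ico, Finset.sum_range]
      simp only [T', Fin.is_lt, dif_pos, Fin.eta]
      have : ∀ a : Fin n, (3 + (if a ∈ S then T a else 0) + 2) =
          5 + if a ∈ S then T a else 0 := fun a => by omega
      simp only [this, Finset.sum_add_distrib]
      simp [mul_comm]
    rw [h1, Finset.sum_ite_mem, Finset.univ_inter]
    omega

theorem _root_.IsAdjacencyArray.sum_degree_le (h : IsAdjacencyArray H off adj) (S : Finset (Fin n))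
    (c e : ℕ) : ∑ a ∈ S, (c * (off (a + 1) - off a) + e) ≤ c * off n + e * n := by
  calc ∑ a ∈ S, (c * (off (a + 1) - off a) + e)
      ≤ ∑ a : Fin n, (c * (off (a + 1) - off a) + e) :=
        Finset.sum_le_sum_of_subset (Finset.subset_univ _)
    _ = ∑ k ∈ Finset.Ico 0 n, (c * (off (k + 1) - off k) + e) := by
        rw [← Finset.range_eq_Ico, Finset.sum_range]
    _ = _ := by
        rw [Finset.sum_add_distrib, ← Finset.mul_sum, h.sum_degree]
        simp [mul_comm]

/-- Find a member of the set in bank `3` with the fewest neighbours in the set. Register `10` tells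
whether there is a member, and register `12` holds it. -/
def findMin : Prog :=
  let update : Prog := .seq (.const 10 1) (.seq (.copy 11 25) (.copy 12 20))
  .seq (.const 10 0) (forMembers 3 20 (.seq (.const 25 0) (.seq (addNbrs 3)
    (.ite (.eq 10 2) update (.ite (.lt 25 11) update .skip)))))

theorem runs_findMin (h : IsAdjacencyArray H off adj) {A : Finset (Fin n)} {σ : State}
    (hG : HasGraph n off adj σ) (hA : HasSet σ 3 A) :
    Runs findMin σ (30 * (n + off n + 1)) fun τ =>
      Frame [10, 11, 12, 13, 20, 21, 22, 23, 24, 25] [] σ τ ∧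
        ((A = ∅ ∧ τ.reg 10 = 0) ∨ (τ.reg 10 = 1 ∧ ∃ a ∈ A, τ.reg 12 = a ∧
          ∀ b ∈ A, (nbrIn H A a).card ≤ (nbrIn H A b).card)) := by
  classical
  refine Runs.mono (Runs.seq (Q := fun τ => τ = σ.setReg 10 0)
    (Runs.of_loopFree (p := .const 10 0) trivial rfl) fun τ hτ =>
    runs_forMembers A (fun X τ => Frame [10, 11, 12, 13, 20, 21, 22, 23, 24, 25] [] σ τ ∧
      ((X = ∅ ∧ τ.reg 10 = 0) ∨ (τ.reg 10 = 1 ∧ ∃ a ∈ X, τ.reg 12 = a ∧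
        τ.reg 11 + 1 = (nbrIn H A a).card ∧
        ∀ b ∈ X, (nbrIn H A a).card ≤ (nbrIn H A b).card)))
      (fun a => 7 * (off (a + 1) - off a) + 20) (by simp) ?_ ?_ ?_ ?_ ?_
      (7 * off n + 20 * n + 5 * n + 2) ?_)
    (B := 1 + (7 * off n + 20 * n + 5 * n + 2)) (by omega) fun _ h => h
  · rintro a ha haA τ ⟨hF, hX⟩ h20
    have hone : (τ.setReg 25 0).reg 20 = a := by simp [h20]
    have hF1 := hF.setReg (i := 25) (x := 0) (by simp)
    refine Runs.mono (Runs.seq (Q := fun τ' => τ' = τ.setReg 25 0)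
      (Runs.of_loopFree (p := .const 25 0) trivial rfl) fun τ' hτ' =>
        Runs.seq (B' := 10) (runs_addNbrs h (S := A) (a := a) (by subst hτ'; exact hG.frame hF1)
          (by subst hτ'; exact hA.frame hF1) (by subst hτ'; exact hone) haA) ?_)
      (B := 1 + (7 * (off (a + 1) - off a) + 5 + 10)) (by omega) fun _ h => h
    subst hτ'
    rintro υ ⟨hFυ, hcount⟩
    have hFυ' : Frame [10, 11, 12, 13, 20, 21, 22, 23, 24, 25] [] σ υ :=
      hF1.trans (hFυ.mono (by simp) (by simp))
    have h2 := (hG.frame hFυ').zero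
    have h10 : υ.reg 10 = τ.reg 10 := by simpa using hFυ.reg 10 (by simp)
    have h11 : υ.reg 11 = τ.reg 11 := by simpa using hFυ.reg 11 (by simp)
    have h12 : υ.reg 12 = τ.reg 12 := by simpa using hFυ.reg 12 (by simp)
    have h20' : υ.reg 20 = a := by rw [hFυ.reg 20 (by simp)]; exact hone
    simp only [State.setReg_reg, if_true, zero_add] at hcount
    refine Runs.mono (Runs.of_loopFree (by simp [Prog.LoopFree]) ?_) (by simp [Prog.cost])
      fun _ h => h
    rcases hX with ⟨hX, hX0⟩ | ⟨hX1, b, hb, hb12, hb11, hmin⟩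
    · simp only [Prog.run, Cond.holds_eq, h10, hX0, h2, if_true]
      refine ⟨by simp [h20'], ((hFυ'.setReg (by simp)).setReg (by simp)).setReg (by simp), Or.inr
        ⟨by simp, a, by simp, by simp [h20'], by simp [hcount], ?_⟩⟩
      intro b hb
      simp only [hX, Finset.mem_cons, Finset.notMem_empty, or_false] at hb
      rw [hb]
    · simp only [Prog.run, Cond.holds_eq, Cond.holds_lt, h10, hX1, h2, one_ne_zero, if_false]
      by_cases hlt : υ.reg 25 < υ.reg 11
      · simp only [hlt, if_true]
        refine ⟨by simp [h20'], ((hFυ'.setReg (by simp)).setReg (by simp)).setReg (by simp), Or.inr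
          ⟨by simp, a, by simp, by simp [h20'], by simp [hcount], ?_⟩⟩
        intro c hc
        rcases Finset.mem_cons.mp hc with rfl | hc
        · exact le_rfl
        · have := hmin c hc
          omega
      · simp only [hlt, if_false]
        refine ⟨h20', hFυ', Or.inr ⟨by rw [h10, hX1], b, by simp [hb], by rw [h12, hb12],
          by rw [h11, hb11], ?_⟩⟩
        intro c hc
        rcases Finset.mem_cons.mp hc with rfl | hc
        · omega
        · exact hmin c hc
  · rintro X τ ⟨hF, -⟩
    exact ⟨(hG.frame hF).size, (hG.frame hF).one, hA.frame hF⟩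
  · rintro X τ x ⟨hF, hX⟩
    exact ⟨⟨hF.setReg (by simp), by simpa using hX⟩, ⟨hF.setReg (by simp), by simpa using hX⟩⟩
  · rintro τ ⟨hF, hX⟩
    refine ⟨hF, hX.imp id ?_⟩
    rintro ⟨h1, a, ha, h2, -, h3⟩
    exact ⟨h1, a, ha, h2, h3⟩
  · subst hτ
    exact ⟨(Frame.refl _ _ _).setReg (by simp), Or.inl ⟨rfl, by simp⟩⟩
  · have := h.sum_degree_le A 7 20
    omega

end RAM

namespace RAM

variable {n : ℕ} {H : SimpleGraph (Fin n)} {off adj : ℕ → ℕ}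

/-- Copy the set in bank `b` to bank `b'`. -/
def copySet (b b' : ℕ) : Prog := forVerts 20 (.seq (.load 24 b 20) (.store b' 20 24))

theorem runs_copySet {b b' : ℕ} (hb : b ≠ b') {S : Finset (Fin n)} {σ : State}
    (hsize : σ.reg 0 = n) (hS : HasSet σ b S) :
    Runs (copySet b b') σ (4 * n + 2) fun τ => Frame [20, 24] [b'] σ τ ∧ HasSet τ b' S := by
  refine Runs.mono (runs_forVerts (fun k τ => Frame [20, 24] [b'] σ τ ∧
    ∀ v : Fin n, v.val < k → τ.mem b' v = if v ∈ S then 1 else 0) (fun _ => 2) ?_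
    (fun k τ hτ => (hτ.1.reg 0 (by simp)).trans hsize) (fun τ hτ => ⟨hτ.1, fun v => hτ.2 v v.2⟩)
    ⟨(Frame.refl _ _ _).setReg (by simp), by simp⟩) (by simp; omega) fun _ h => h
  rintro k hk τ ⟨hF, hτ⟩ h20
  refine Runs.of_loopFree (p := .seq (.load 24 b 20) (.store b' 20 24)) (by simp [Prog.LoopFree]) ?_
  have hmem : τ.mem b k = if (⟨k, hk⟩ : Fin n) ∈ S then 1 else 0 := by
    rw [hF.mem b (by simp [hb])]; exact hS ⟨k, hk⟩
  refine ⟨by simp [Prog.run, h20],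
    ((hF.setReg (by simp)).setMem (by simp)).setReg (by simp), fun v hv => ?_⟩
  by_cases hvk : v.val = k
  · subst hvk
    simpa [Prog.run, h20] using hmem
  · have := hτ v (by omega)
    simpa [Prog.run, h20, Function.update_apply, hvk] using this

/-- Write to bank `4` the closed neighbourhood, within the set in bank `b`, of the vertex in
register `12`. -/
def storeNbrs (b : ℕ) : Prog :=
  .seq (forVerts 20 (.store 4 20 2)) (.seq (.store 4 12 1)
    (forNbrs 12 (.seq (.load 24 b 23) (.ite (.eq 24 1) (.store 4 23 1) .skip))))

theorem runs_storeNbrs (h : IsAdjacencyArray H off adj) {b : ℕ} (hb : b ≠ 4)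
    {S : Finset (Fin n)} {σ : State} (hG : HasGraph n off adj σ) (hS : HasSet σ b S) {a : Fin n}
    (ha : σ.reg 12 = a) (haS : a ∈ S) :
    Runs (storeNbrs b) σ (8 * (n + off n + 1)) fun τ =>
      Frame [20, 21, 22, 23, 24] [4] σ τ ∧ HasSet τ 4 (nbrIn H S a) := by
  classical
  have hdeg := h.off_succ_le a.2
  refine Runs.mono (Runs.seq (B' := 1 + (7 * (off (a + 1) - off a) + 5)) (runs_forVerts (n := n)
    (Q := fun τ => Frame [20, 21, 22, 23, 24] [4] σ τ ∧ ∀ v : Fin n, τ.mem 4 v = 0)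
    (fun k τ => Frame [20, 21, 22, 23, 24] [4] σ τ ∧ ∀ v : Fin n, v.val < k → τ.mem 4 v = 0)
    (fun _ => 1) ?_ (fun k τ hτ => (hτ.1.reg 0 (by simp)).trans hG.size)
    (fun τ hτ => ⟨hτ.1, fun v => hτ.2 v v.2⟩)
    ⟨(Frame.refl _ _ _).setReg (by simp), by simp⟩) ?_) (by simp; omega) fun _ h => h
  · rintro k hk τ ⟨hF, hτ⟩ h20
    have h2 := (hG.frame hF).zero
    refine Runs.of_loopFree (p := .store 4 20 2) trivial ?_
    refine ⟨by simp [Prog.run, h20], (hF.setMem (by simp)).setReg (by simp), fun v hv => ?_⟩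
    by_cases hvk : v.val = k
    · simp [Prog.run, h20, hvk, h2]
    · simpa [Prog.run, h20, Function.update_apply, hvk] using hτ v (by omega)
  · rintro τ ⟨hF, hτ⟩
    have h1 := (hG.frame hF).one
    have h12 : τ.reg 12 = a := (hF.reg 12 (by simp)).trans ha
    refine Runs.seq (Q := fun υ => υ = τ.setMem 4 a 1)
      (Runs.of_loopFree (p := .store 4 12 1) trivial (by simp [Prog.run, h12, h1])) fun υ hυ => ?_
    subst hυ
    have hF1 : Frame [20, 21, 22, 23, 24] [4] σ (τ.setMem 4 a 1) := hF.setMem (by simp)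
    refine runs_forNbrs h (fun i υ => Frame [20, 21, 22, 23, 24] [4] σ υ ∧
      ∀ v : Fin n, υ.mem 4 v =
        if v ∈ S ∧ (a = v ∨ ∃ j ∈ Finset.Ico (off a) i, adj j = v) then 1 else 0) 4 _ ?_ ?_
      (by simp) (by simpa using h12) (hG.frame hF1).off (hG.frame hF1).adj
      ⟨(hF1.setReg (by simp)).setReg (by simp), fun v => ?_⟩
    · rintro i hi υ ⟨hFυ, hυ⟩ h21 h22 hadj
      have hlt := h.adj_lt a a.2 i hi
      have hb' := hFυ.mem b (by simp [hb])
      have h1' := (hG.frame hFυ).one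
      have hIco : ∀ v : Fin n, (∃ j ∈ Finset.Ico (off a) (i + 1), adj j = v) ↔
          adj i = v ∨ ∃ j ∈ Finset.Ico (off a) i, adj j = v := by
        intro v
        rw [← Finset.insert_Ico_right_eq_Ico_add_one (Finset.mem_Ico.mp hi).1]
        simp
      refine Runs.of_loopFree (p := .seq (.load 24 b 23) (.ite (.eq 24 1) (.store 4 23 1) .skip))
        (by simp [Prog.LoopFree]) ?_
      by_cases hin : (⟨adj i, hlt⟩ : Fin n) ∈ S
      · have h2 : υ.mem b (adj i) = 1 := by rw [hb']; exact hS.eq_one hin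
        simp only [Prog.run, Cond.holds_eq, State.setReg_reg, State.setReg_mem, if_true]
        simp only [show (1 : ℕ) ≠ 23 by norm_num, show (1 : ℕ) ≠ 24 by norm_num, h2, h1', if_true,
          if_false]
        refine ⟨by simp [h21], by simp [h22], by simp [hadj],
          (((hFυ.setReg (by simp)).setReg (by simp)).setMem (by simp)).setReg (by simp),
          fun v => ?_⟩
        simp only [hIco]
        by_cases hv : adj i = v
        · have hv' : v ∈ S := (Fin.ext hv : (⟨adj i, hlt⟩ : Fin n) = v) ▸ hin
          simp [hv, hv']
        · have hv' : ¬ (v : ℕ) = adj i := fun h => hv h.symm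
          simpa [hv, hv', Function.update_apply] using hυ v
      · have h2 : υ.mem b (adj i) = 0 := by rw [hb']; exact hS.eq_zero hin
        simp only [Prog.run, Cond.holds_eq, State.setReg_reg, State.setReg_mem, if_true]
        simp only [show (1 : ℕ) ≠ 23 by norm_num, show (1 : ℕ) ≠ 24 by norm_num, h2, h1',
          zero_ne_one, if_false]
        refine ⟨by simp [h21], by simp [h22], by simp [hadj],
          ((hFυ.setReg (by simp)).setReg (by simp)).setReg (by simp), fun v => ?_⟩
        simp only [hIco]
        by_cases hv : adj i = v
        · have hv' : v ∉ S := (Fin.ext hv : (⟨adj i, hlt⟩ : Fin n) = v) ▸ hin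
          simpa [hv'] using hυ v
        · simpa [hv] using hυ v
    · rintro υ ⟨hFυ, hυ⟩
      refine ⟨hFυ, fun v => ?_⟩
      rw [hυ v]
      simp only [mem_nbrIn, h.adj_iff a v]
    · by_cases hv : a = v
      · subst hv; simp [haS]
      · have hv' : ¬ (v : ℕ) = a := fun h => hv (Fin.ext h.symm)
        simp [hv, hv', hτ v]

/-- Count the members of the set in bank `4` (register `15`) and the pairs of equal or adjacent
members (register `25`). -/
def countPairs : Prog :=
  .seq (.seq (.const 25 0) (.const 15 0))
    (forMembers 4 20 (.seq (.seq (.inc 25) (.inc 15)) (addNbrs 4)))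

theorem runs_countPairs (h : IsAdjacencyArray H off adj) {S : Finset (Fin n)} {σ : State}
    (hG : HasGraph n off adj σ) (hS : HasSet σ 4 S) :
    Runs countPairs σ (13 * (n + off n + 1)) fun τ =>
      Frame [13, 15, 20, 21, 22, 23, 24, 25] [] σ τ ∧ τ.reg 25 = pairCount H S ∧
        τ.reg 15 = S.card := by
  refine Runs.mono (Runs.seq (Q := fun τ => τ = (σ.setReg 25 0).setReg 15 0)
    (Runs.of_loopFree (p := .seq (.const 25 0) (.const 15 0)) (by simp [Prog.LoopFree]) rfl)
    fun τ hτ => runs_forMembers S (fun X τ => Frame [13, 15, 20, 21, 22, 23, 24, 25] [] σ τ ∧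
      τ.reg 25 = ∑ a ∈ X, (nbrIn H S a).card ∧ τ.reg 15 = X.card)
      (fun a => 7 * (off (a + 1) - off a) + 7) (by simp) ?_ ?_ ?_ ?_ ?_
      (7 * off n + 7 * n + 5 * n + 2) ?_)
    (B := 2 + (7 * off n + 7 * n + 5 * n + 2)) (by omega) fun _ h => h
  · rintro a ha haS τ ⟨hF, h25, h15⟩ h20
    have hF1 := (hF.setReg (i := 25) (x := τ.reg 25 + 1) (by simp)).setReg (i := 15)
      (x := τ.reg 15 + 1) (by simp)
    refine Runs.mono (Runs.seq
      (Q := fun τ' => τ' = (τ.setReg 25 (τ.reg 25 + 1)).setReg 15 (τ.reg 15 + 1))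
      (Runs.of_loopFree (p := .seq (.inc 25) (.inc 15)) (by simp [Prog.LoopFree])
        (by simp [Prog.run])) fun τ' hτ' => ?_)
      (B := 2 + (7 * (off (a + 1) - off a) + 5)) (by omega) fun _ h => h
    subst hτ'
    refine (runs_addNbrs h (S := S) (a := a) (hG.frame hF1) (hS.frame hF1) (by simp [h20])
      haS).mono le_rfl ?_
    rintro υ ⟨hFυ, hcount⟩
    refine ⟨?_, hF1.trans (hFυ.mono (by simp) (by simp)), ?_, ?_⟩
    · rw [hFυ.reg 20 (by simp)]; simp [h20]
    · simp only [State.setReg_reg, if_true, h25] at hcount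
      rw [Finset.sum_cons]
      simp at hcount
      omega
    · rw [hFυ.reg 15 (by simp), Finset.card_cons]; simp [h15]
  · rintro X τ ⟨hF, -⟩
    exact ⟨(hG.frame hF).size, (hG.frame hF).one, hS.frame hF⟩
  · rintro X τ x ⟨hF, hX⟩
    exact ⟨⟨hF.setReg (by simp), by simpa using hX⟩, ⟨hF.setReg (by simp), by simpa using hX⟩⟩
  · rintro τ hτ
    exact hτ
  · subst hτ
    exact ⟨((Frame.refl _ _ _).setReg (by simp)).setReg (by simp), by simp, by simp⟩
  · have := h.sum_degree_le S 7 7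
    omega

/-- Store in bank `4` the closed neighbourhood of the vertex in register `12` within the set in
bank `b`, and count its members and pairs. -/
def evalNbrs (b : ℕ) : Prog := .seq (storeNbrs b) countPairs

theorem runs_evalNbrs (h : IsAdjacencyArray H off adj) {b : ℕ} (hb : b ≠ 4)
    {S : Finset (Fin n)} {σ : State} (hG : HasGraph n off adj σ) (hS : HasSet σ b S) {a : Fin n}
    (ha : σ.reg 12 = a) (haS : a ∈ S) :
    Runs (evalNbrs b) σ (21 * (n + off n + 1)) fun τ =>
      Frame [13, 15, 20, 21, 22, 23, 24, 25] [4] σ τ ∧ HasSet τ 4 (nbrIn H S a) ∧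
        τ.reg 25 = pairCount H (nbrIn H S a) ∧ τ.reg 15 = (nbrIn H S a).card := by
  refine Runs.mono (Runs.seq (runs_storeNbrs h hb hG hS ha haS) fun τ hτ =>
    (runs_countPairs h (hG.frame hτ.1) hτ.2).mono le_rfl fun υ hυ =>
      ⟨(hτ.1.mono (by simp) (by simp)).trans (hυ.1.mono (by simp) (by simp)), hτ.2.frame hυ.1,
        hυ.2⟩) (by omega) fun _ h => h

end RAM

theorem pairCount_pos {W : Type w} {H : SimpleGraph W} {S : Finset W} {a : W} (ha : a ∈ S) :
    0 < pairCount H S :=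
  lt_of_lt_of_le (Finset.card_pos.mpr ⟨a, mem_nbrIn.mpr ⟨ha, Or.inl rfl⟩⟩)
    (Finset.single_le_sum (f := fun a => (nbrIn H S a).card) (fun _ _ => Nat.zero_le _) ha)

theorem exists_not_adj_of_card_lt {W : Type w} {H : SimpleGraph W} {S : Finset W} {a : W} :
    (nbrIn H S a).card < S.card ↔ ∃ b ∈ S, ¬ (a = b ∨ H.Adj a b) := by
  constructor
  · intro h
    obtain ⟨b, hb, hb'⟩ := Finset.exists_mem_notMem_of_card_lt_card h
    exact ⟨b, hb, fun h' => hb' (mem_nbrIn.mpr ⟨hb, h'⟩)⟩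
  · rintro ⟨b, hb, hb'⟩
    exact Finset.card_lt_card (Finset.ssubset_iff_subset_ne.mpr ⟨nbrIn_subset, fun h =>
      hb' (mem_nbrIn.mp (h.symm.subset hb)).2⟩)

namespace RAM

variable {n : ℕ} {H : SimpleGraph (Fin n)} {off adj : ℕ → ℕ}

theorem _root_.IsAdjacencyArray.card_nbrIn_le (h : IsAdjacencyArray H off adj)
    {S : Finset (Fin n)} {a : Fin n} (ha : a ∈ S) : (nbrIn H S a).card ≤ off n + 1 := by
  classical
  rw [← h.card_cells a ha]
  have h1 := Finset.card_filter_le (Finset.Ico (off a) (off (a + 1)))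
    (fun i => ∃ x ∈ S, adj i = x.val)
  rw [Nat.card_Ico] at h1
  have h2 := h.off_succ_le a.2
  omega

/-! ### The first vertex set -/

/-- If the set in bank `4` has more pairs than recorded in register `17`, copy it to bank `6`. -/
def keepBetter : Prog := .ite (.lt 17 25) (.seq (.copy 17 25) (copySet 4 6)) .skip

theorem runs_keepBetter {S T : Finset (Fin n)} {σ : State} (hsize : σ.reg 0 = n)
    (h4 : HasSet σ 4 S) (h6 : HasSet σ 6 T) :
    Runs keepBetter σ (4 * n + 4) fun τ => Frame [17, 20, 24] [6] σ τ ∧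
      ((σ.reg 17 < σ.reg 25 ∧ τ.reg 17 = σ.reg 25 ∧ HasSet τ 6 S) ∨
        (σ.reg 25 ≤ σ.reg 17 ∧ τ.reg 17 = σ.reg 17 ∧ HasSet τ 6 T)) := by
  refine Runs.mono (Runs.ite (B := 4 * n + 3) (fun hc => ?_) (fun hc => ?_)) (by omega)
    fun _ h => h
  · refine Runs.mono (Runs.seq (Q := fun τ => τ = σ.setReg 17 (σ.reg 25))
      (Runs.of_loopFree (p := .copy 17 25) trivial rfl) fun τ hτ => ?_)
      (B := 1 + (4 * n + 2)) (by omega) fun _ h => h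
    subst hτ
    refine (runs_copySet (b := 4) (b' := 6) (σ := σ.setReg 17 (σ.reg 25)) (by simp) (by simpa using hsize) h4).mono le_rfl ?_
    rintro τ ⟨hF, h6'⟩
    refine ⟨((Frame.refl _ _ _).setReg (by simp)).trans (hF.mono (by simp) (by simp)), Or.inl
      ⟨hc, ?_, h6'⟩⟩
    rw [hF.reg 17 (by simp)]; simp
  · refine Runs.mono (Runs.of_loopFree (p := .skip) trivial ?_) (by simp [Prog.cost]) fun _ h => h
    exact ⟨Frame.refl _ _ _, Or.inr ⟨not_lt.mp hc, rfl, h6⟩⟩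

/-- Repeatedly delete a vertex of minimum degree from the set in bank `3`, and keep in bank `6` the
closed neighbourhood with most pairs among those of the deleted vertices. -/
def peel : Prog :=
  .seq (.const 10 1) (.loop (.eq 10 1) (.seq findMin (.ite (.eq 10 1)
    (.seq (evalNbrs 3) (.seq keepBetter (.store 3 12 2))) .skip)))

theorem runs_peel (h : IsAdjacencyArray H off adj) {k ω : ℕ} (hH : CliqueDense H k)
    (hω : ∀ Q : Finset (Fin n), H.IsClique (Q : Set (Fin n)) → Q.card ≤ ω)
    {A₀ T₀ : Finset (Fin n)} {σ : State} (hG : HasGraph n off adj σ) (hA₀ : HasSet σ 3 A₀)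
    (hT₀ : HasSet σ 6 T₀) (h17 : σ.reg 17 = 1) (hT₀ω : T₀.card ≤ k * ω)
    (hT₀off : T₀.card ≤ off n + 1) (hT₀1 : n = 0 ∨ 1 ≤ pairCount H T₀) :
    Runs peel σ (65 * ((A₀.card + 1) * (n + off n + 1))) fun τ =>
      HasGraph n off adj τ ∧ ∃ T : Finset (Fin n), HasSet τ 6 T ∧ T.card ≤ k * ω ∧
        T.card ≤ off n + 1 ∧ (n = 0 ∨ 1 ≤ pairCount H T) ∧
        ∀ Q ⊆ A₀, H.IsClique (Q : Set (Fin n)) → Q.Nonempty →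
          Q.card * Q.card ≤ pairCount H T := by
  classical
  set N := n + off n + 1 with hN
  refine Runs.mono (Runs.seq (Q := fun τ => τ = σ.setReg 10 1)
    (Runs.of_loopFree (p := .const 10 1) trivial rfl) fun τ hτ =>
    Runs.loop (B := 60 * N) (fun m τ => HasGraph n off adj τ ∧ ∃ A T : Finset (Fin n),
      HasSet τ 3 A ∧ HasSet τ 6 T ∧ T.card ≤ k * ω ∧ T.card ≤ off n + 1 ∧ 1 ≤ τ.reg 17 ∧
      (n = 0 ∨ τ.reg 17 ≤ pairCount H T) ∧
      (∀ Q ⊆ A₀, H.IsClique (Q : Set (Fin n)) → ¬ Q ⊆ A → Q.card * Q.card ≤ τ.reg 17) ∧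
      ((τ.reg 10 = 1 ∧ m = A.card + 1) ∨ (τ.reg 10 = 0 ∧ A = ∅ ∧ m = 0)))
      ?_ ?_ (A₀.card + 1) ?_)
    (B := 1 + ((A₀.card + 1) * (60 * N + 1) + 1)) ?_ fun _ h => h
  · rintro m τ ⟨hG, A, T, hA, hT, hTω, hToff, hpos, hbest, hQ, hm⟩ hc
    simp only [Cond.holds_eq, hG.one] at hc
    rcases hm with ⟨-, rfl⟩ | ⟨h0, -⟩
    swap
    · omega
    by_cases hAe : A = ∅
    · refine ⟨0, by omega, ?_⟩
      refine Runs.mono (Runs.seq (runs_findMin h hG hA) fun υ hυ => ?_)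
        (B := 30 * N + 2) (by omega) fun _ h => h
      obtain ⟨hF, hcase⟩ := hυ
      have h10 : υ.reg 10 = 0 := by
        rcases hcase with ⟨-, h0⟩ | ⟨-, a, ha, -⟩
        · exact h0
        · simp [hAe] at ha
      have hG' := hG.frame hF
      refine Runs.ite (B := 1) (fun hc' => ?_) (fun _ => ?_)
      · simp [h10, hG'.one] at hc'
      · refine Runs.of_loopFree (p := .skip) trivial ?_
        have h17' := hF.reg 17 (by simp)
        simp only [Prog.run]
        rw [h17']
        exact ⟨hG', A, T, hA.frame hF, hT.frame hF, hTω, hToff, hpos, hbest, hQ,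
          Or.inr ⟨h10, hAe, trivial⟩⟩
    · refine ⟨A.card, by omega, ?_⟩
      refine Runs.mono (Runs.seq (runs_findMin h hG hA) fun υ hυ => ?_)
        (B := 30 * N + (1 + (21 * N + (4 * n + 4 + 1)))) (by omega) fun _ h => h
      obtain ⟨hF, hcase⟩ := hυ
      have hG' := hG.frame hF
      obtain ⟨h10, a, haA, h12, hmin⟩ := hcase.resolve_left fun h => hAe h.1
      refine Runs.ite (fun _ => ?_) (fun hc' => (hc' (by simp [h10, hG'.one])).elim)
      refine Runs.seq (runs_evalNbrs h (by simp) hG' (hA.frame hF) h12 haA) ?_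
      rintro υ₁ ⟨hF₁, h4, h25, -⟩
      have hG₁ := hG'.frame hF₁
      refine Runs.seq (runs_keepBetter hG₁.size h4 ((hT.frame hF).frame hF₁)) ?_
      rintro υ₂ ⟨hF₂, hbetter⟩
      have hG₂ := hG₁.frame hF₂
      refine Runs.of_loopFree (p := .store 3 12 2) trivial ?_
      have h17₁ : υ₁.reg 17 = τ.reg 17 := (hF₁.reg 17 (by simp)).trans (hF.reg 17 (by simp))
      have h12₂ : υ₂.reg 12 = a := by
        rw [hF₂.reg 12 (by simp), hF₁.reg 12 (by simp), h12]
      have h10₂ : υ₂.reg 10 = 1 := by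
        rw [hF₂.reg 10 (by simp), hF₁.reg 10 (by simp), h10]
      have hA₂ : HasSet υ₂ 3 A := ((hA.frame hF).frame hF₁).frame hF₂
      have hstore : Prog.run (.store 3 12 2) υ₂ = υ₂.setMem 3 a 0 := by
        simp [Prog.run, h12₂, hG₂.zero]
      rw [hstore]
      have hF₃ : Frame [] [3] υ₂ (υ₂.setMem 3 a 0) := (Frame.refl _ _ _).setMem (by simp)
      have hA₃ : HasSet (υ₂.setMem 3 a 0) 3 (A.erase a) := by
        intro v
        by_cases hv : v = a
        · subst hv; simp
        · have hv' : (v : ℕ) ≠ a := fun h => hv (Fin.ext h)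
          simpa [Function.update_apply, hv, hv'] using hA₂ v
      have hnew : ∀ Q ⊆ A₀, H.IsClique (Q : Set (Fin n)) → ¬ Q ⊆ A.erase a →
          Q.card * Q.card ≤ max (υ₁.reg 17) (υ₁.reg 25) := by
        intro Q hQA hQc hQe
        by_cases hQA' : Q ⊆ A
        · have haQ : a ∈ Q := by
            by_contra haQ
            exact hQe fun x hx => Finset.mem_erase.mpr ⟨fun h => haQ (h ▸ hx), hQA' hx⟩
          refine le_trans ?_ (le_max_right _ _)
          rw [h25]
          exact (sq_card_le_pairCount hQc).trans
            (pairCount_mono (subset_nbrIn_of_isClique hQc hQA' haQ))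
        · refine le_trans ?_ (le_max_left _ _)
          rw [h17₁]
          exact hQ Q hQA hQc hQA'
      have hm : A.card = (A.erase a).card + 1 := (Finset.card_erase_add_one haA).symm
      refine ⟨hG₂.frame hF₃, ?_⟩
      simp only [State.setMem_reg]
      rcases hbetter with ⟨hlt, h17₂, h6⟩ | ⟨hle, h17₂, h6⟩
      · refine ⟨A.erase a, nbrIn H A a, hA₃, h6.frame hF₃, hH.card_nbrIn_le hω haA hmin,
          h.card_nbrIn_le haA, by omega, Or.inr (by rw [h17₂, h25]), ?_, Or.inl ⟨h10₂, hm⟩⟩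
        rw [h17₂, ← max_eq_right hlt.le]
        exact hnew
      · refine ⟨A.erase a, T, hA₃, h6.frame hF₃, hTω, hToff, by omega, ?_, ?_, Or.inl ⟨h10₂, hm⟩⟩
        · rw [h17₂, h17₁]; exact hbest
        · rw [h17₂, ← max_eq_left hle]
          exact hnew
  · rintro m τ ⟨hG, A, T, hA, hT, hTω, hToff, hpos, hbest, hQ, hm⟩ hc
    simp only [Cond.holds_eq, hG.one] at hc
    obtain ⟨-, rfl, -⟩ := hm.resolve_left fun h => hc h.1
    refine ⟨hG, T, hT, hTω, hToff, hbest.imp id fun h => hpos.trans h, ?_⟩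
    intro Q hQA hQc hQne
    rcases hbest with h0 | hbest
    · subst h0
      exact hQne.choose.elim0
    · exact (hQ Q hQA hQc fun h => hQne.ne_empty (Finset.subset_empty.mp h)).trans hbest
  · subst hτ
    have hF : Frame [10] [] σ (σ.setReg 10 1) := (Frame.refl _ _ _).setReg (by simp)
    refine ⟨hG.frame hF, A₀, T₀, hA₀, hT₀, hT₀ω, hT₀off, by simp [h17], ?_, ?_, Or.inl ⟨by simp, rfl⟩⟩
    · simpa [h17] using hT₀1
    · intro Q h1 _ h2
      exact (h2 h1).elim
  · have h1 : 1 ≤ N := by omega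
    have h2 : A₀.card + 1 ≤ (A₀.card + 1) * N := Nat.le_mul_of_pos_right _ h1
    have h3 : (A₀.card + 1) * (60 * N + 1) = 60 * ((A₀.card + 1) * N) + (A₀.card + 1) := by ring
    omega

/-! ### Refinement -/

/-- Replace the set `S` in bank `6` by `S ∩ N[a]` with most pairs among the members `a` of `S` that
are not adjacent to all of `S`; register `18` tells whether there is such an `a`, and bank `5` keeps
`S`. -/
def refineStep : Prog :=
  .seq (copySet 6 5) (.seq (.seq (.const 18 0) (.seq (.const 17 0) (.const 19 0)))
    (.seq (forMembers 5 20 (.inc 19)) (forMembers 5 12 (.seq (evalNbrs 5)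
      (.ite (.lt 15 19) (.seq (.const 18 1) keepBetter) .skip)))))

theorem runs_refineStep (h : IsAdjacencyArray H off adj) {S : Finset (Fin n)} {σ : State}
    (hG : HasGraph n off adj σ) (hS : HasSet σ 6 S) :
    Runs refineStep σ (45 * ((S.card + 1) * (n + off n + 1))) fun τ =>
      HasGraph n off adj τ ∧
        ((τ.reg 18 = 0 ∧ HasSet τ 5 S ∧ HasSet τ 6 S ∧
            ∀ a ∈ S, ¬ ∃ b ∈ S, ¬ (a = b ∨ H.Adj a b)) ∨
          (τ.reg 18 = 1 ∧ ∃ a ∈ S, (∃ b ∈ S, ¬ (a = b ∨ H.Adj a b)) ∧ HasSet τ 6 (nbrIn H S a) ∧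
            ∀ a' ∈ S, (∃ b ∈ S, ¬ (a' = b ∨ H.Adj a' b)) →
              pairCount H (nbrIn H S a') ≤ pairCount H (nbrIn H S a))) := by
  set N := n + off n + 1 with hN
  have htime : S.card * N + N = (S.card + 1) * N := by ring
  have hSN : S.card ≤ S.card * N := Nat.le_mul_of_pos_right _ (by omega)
  refine Runs.mono (Runs.seq (runs_copySet (by simp) hG.size hS) fun σ₁ hσ₁ => ?_)
    (B := 4 * n + 2 + (3 + ((S.card + 5 * n + 2) + (S.card * (30 * N) + 5 * n + 2)))) (by
      have : S.card * (30 * N) = 30 * (S.card * N) := by ring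
      omega) fun _ h => h
  obtain ⟨hF₁, h5₁⟩ := hσ₁
  refine Runs.seq (Q := fun σ₂ => σ₂ = ((σ₁.setReg 18 0).setReg 17 0).setReg 19 0)
    (Runs.of_loopFree (p := .seq (.const 18 0) (.seq (.const 17 0) (.const 19 0)))
      (by simp [Prog.LoopFree]) rfl) fun σ₂ hσ₂ => ?_
  have hF₂ : Frame [17, 18, 19] [] σ₁ σ₂ := by
    subst hσ₂
    exact (((Frame.refl _ _ _).setReg (by simp)).setReg (by simp)).setReg (by simp)
  have h17₂ : σ₂.reg 17 = 0 := by subst hσ₂; simp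
  have h18₂ : σ₂.reg 18 = 0 := by subst hσ₂; simp
  have h19₂ : σ₂.reg 19 = 0 := by subst hσ₂; simp
  have hG₂ := (hG.frame hF₁).frame hF₂
  have h5₂ := h5₁.frame hF₂
  have h6₂ := (hS.frame hF₁).frame hF₂
  clear hσ₂
  refine Runs.seq (Q := fun σ₃ => Frame [13, 19, 20] [] σ₂ σ₃ ∧ σ₃.reg 19 = S.card)
    (runs_forMembers S (fun X τ => Frame [13, 19, 20] [] σ₂ τ ∧ τ.reg 19 = X.card) (fun _ => 1)
      (by simp) ?_ ?_ ?_ (fun τ hτ => hτ) ⟨Frame.refl _ _ _, by simp [h19₂]⟩ _ (by simp)) ?_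
  · rintro a ha - τ ⟨hF, h19⟩ h20
    refine Runs.of_loopFree (p := .inc 19) trivial ?_
    exact ⟨by simp [Prog.run, h20], hF.setReg (by simp), by
      rw [Finset.card_cons]; simp [Prog.run, h19]⟩
  · rintro X τ ⟨hF, -⟩
    exact ⟨(hG₂.frame hF).size, (hG₂.frame hF).one, h5₂.frame hF⟩
  · rintro X τ x ⟨hF, h19⟩
    exact ⟨⟨hF.setReg (by simp), by simpa using h19⟩, ⟨hF.setReg (by simp), by simpa using h19⟩⟩
  rintro σ₃ ⟨hF₃, h19₃⟩
  have h17₃ : σ₃.reg 17 = 0 := (hF₃.reg 17 (by simp)).trans h17₂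
  have h18₃ : σ₃.reg 18 = 0 := (hF₃.reg 18 (by simp)).trans h18₂
  have hG₃ := hG₂.frame hF₃
  have h5₃ := h5₂.frame hF₃
  have h6₃ := h6₂.frame hF₃
  refine runs_forMembers S (fun X τ =>
    Frame [12, 13, 15, 17, 18, 20, 21, 22, 23, 24, 25] [4, 6] σ₃ τ ∧
      ((τ.reg 18 = 0 ∧ τ.reg 17 = 0 ∧ HasSet τ 6 S ∧
          ∀ a ∈ X, ¬ (nbrIn H S a).card < S.card) ∨
        (τ.reg 18 = 1 ∧ ∃ a ∈ S, (nbrIn H S a).card < S.card ∧ HasSet τ 6 (nbrIn H S a) ∧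
          τ.reg 17 = pairCount H (nbrIn H S a) ∧
          ∀ a' ∈ X, (nbrIn H S a').card < S.card →
            pairCount H (nbrIn H S a') ≤ τ.reg 17)))
    (fun _ => 30 * N) (by simp) ?_ ?_ ?_ ?_ ⟨Frame.refl _ _ _, Or.inl ⟨h18₃, h17₃, h6₃, by simp⟩⟩
    _ (by simp)
  · rintro a ha haS τ ⟨hF, hX⟩ h12
    have h6τ : ∃ T : Finset (Fin n), HasSet τ 6 T := by
      rcases hX with hX | ⟨-, a', -, -, h6, -⟩
      exacts [⟨_, hX.2.2.1⟩, ⟨_, h6⟩]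
    refine Runs.mono (Runs.seq (runs_evalNbrs h (by simp) (hG₃.frame hF) (h5₃.frame hF) h12 haS)
      fun υ hυ => ?_) (B := 21 * N + (1 + (1 + (4 * n + 4)))) (by omega) fun _ h => h
    obtain ⟨hFυ, h4, h25, h15⟩ := hυ
    have hF' := hF.trans (hFυ.mono (R' := [12, 13, 15, 17, 18, 20, 21, 22, 23, 24, 25])
      (B' := [4, 6]) (by simp) (by simp))
    have hGυ := hG₃.frame hF'
    have h12υ : υ.reg 12 = a := (hFυ.reg 12 (by simp)).trans h12
    have h17υ : υ.reg 17 = τ.reg 17 := hFυ.reg 17 (by simp)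
    have h18υ : υ.reg 18 = τ.reg 18 := hFυ.reg 18 (by simp)
    have h19υ : υ.reg 19 = S.card := (hF'.reg 19 (by simp)).trans h19₃
    refine Runs.ite (fun hc => ?_) (fun hc => ?_)
    · simp only [Cond.holds_lt, h15, h19υ] at hc
      refine Runs.seq (Q := fun υ' => υ' = υ.setReg 18 1)
        (Runs.of_loopFree (p := .const 18 1) trivial rfl) fun υ' hυ' => ?_
      have hFs : Frame [18] [] υ υ' := by subst hυ'; exact (Frame.refl _ _ _).setReg (by simp)
      have h18s : υ'.reg 18 = 1 := by subst hυ'; simp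
      clear hυ'
      have hpos : 0 < pairCount H (nbrIn H S a) :=
        pairCount_pos (mem_nbrIn.mpr ⟨haS, Or.inl rfl⟩)
      have hfinish : ∀ ρ : State,
          Frame [17, 20, 24] [6] υ' ρ → ρ.reg 12 = a ∧
            Frame [12, 13, 15, 17, 18, 20, 21, 22, 23, 24, 25] [4, 6] σ₃ ρ ∧ ρ.reg 18 = 1 := by
        intro ρ hFρ
        refine ⟨?_, ?_, ?_⟩
        · rw [hFρ.reg 12 (by simp), hFs.reg 12 (by simp), h12υ]
        · exact hF'.trans ((hFs.mono (by simp) (by simp)).trans (hFρ.mono (by simp) (by simp)))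
        · rw [hFρ.reg 18 (by simp), h18s]
      have h17s : υ'.reg 17 = τ.reg 17 := (hFs.reg 17 (by simp)).trans h17υ
      have h25s : υ'.reg 25 = pairCount H (nbrIn H S a) := (hFs.reg 25 (by simp)).trans h25
      obtain ⟨T, hT⟩ := h6τ
      have hTs := (hT.frame hFυ).frame hFs
      rcases hX with ⟨-, hX17, -, hX⟩ | ⟨hX18, b, hbS, hb, hb6, hb17, hmax⟩
      · refine (runs_keepBetter (hGυ.frame hFs).size (h4.frame hFs) hTs).mono le_rfl ?_
        rintro ρ ⟨hFρ, hcase⟩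
        obtain ⟨h1, h2, h3⟩ := hfinish ρ hFρ
        obtain ⟨-, h17ρ, h6ρ⟩ := hcase.resolve_right fun hle => by omega
        refine ⟨h1, h2, Or.inr ⟨h3, a, haS, hc, h6ρ, h17ρ.trans h25s, ?_⟩⟩
        intro a' ha' hlt
        rcases Finset.mem_cons.mp ha' with rfl | ha'
        · rw [h17ρ, h25s]
        · exact (hX a' ha' hlt).elim
      · refine (runs_keepBetter (hGυ.frame hFs).size (h4.frame hFs)
          ((hb6.frame hFυ).frame hFs)).mono le_rfl ?_
        rintro ρ ⟨hFρ, hcase⟩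
        obtain ⟨h1, h2, h3⟩ := hfinish ρ hFρ
        rcases hcase with ⟨hlt, h17ρ, h6ρ⟩ | ⟨hle, h17ρ, h6ρ⟩
        · refine ⟨h1, h2, Or.inr ⟨h3, a, haS, hc, h6ρ, h17ρ.trans h25s, ?_⟩⟩
          intro a' ha' hlt'
          rcases Finset.mem_cons.mp ha' with rfl | ha'
          · rw [h17ρ, h25s]
          · have := hmax a' ha' hlt'
            omega
        · refine ⟨h1, h2, Or.inr ⟨h3, b, hbS, hb, h6ρ, by rw [h17ρ, h17s, hb17], ?_⟩⟩
          intro a' ha' hlt'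
          rcases Finset.mem_cons.mp ha' with rfl | ha'
          · omega
          · have := hmax a' ha' hlt'
            omega
    · simp only [Cond.holds_lt, h15, h19υ] at hc
      refine Runs.mono (Runs.of_loopFree (p := .skip) trivial ?_) (by simp [Prog.cost]) fun _ h => h
      simp only [Prog.run]
      rw [h17υ, h18υ]
      refine ⟨h12υ, hF', ?_⟩
      rcases hX with ⟨hX18, hX17, h6, hX⟩ | ⟨hX18, b, hbS, hb, hb6, hb17, hmax⟩
      · refine Or.inl ⟨hX18, hX17, h6.frame hFυ, ?_⟩
        intro a' ha'
        rcases Finset.mem_cons.mp ha' with rfl | ha'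
        exacts [hc, hX a' ha']
      · refine Or.inr ⟨hX18, b, hbS, hb, hb6.frame hFυ, hb17, ?_⟩
        intro a' ha' hlt'
        rcases Finset.mem_cons.mp ha' with rfl | ha'
        exacts [(hc hlt').elim, hmax a' ha' hlt']
  · rintro X τ ⟨hF, -⟩
    exact ⟨(hG₃.frame hF).size, (hG₃.frame hF).one, h5₃.frame hF⟩
  · rintro X τ x ⟨hF, hX⟩
    exact ⟨⟨hF.setReg (by simp), by simpa [HasSet] using hX⟩,
      ⟨hF.setReg (by simp), by simpa [HasSet] using hX⟩⟩
  · rintro τ ⟨hF, hX⟩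
    refine ⟨hG₃.frame hF, ?_⟩
    simp only [← exists_not_adj_of_card_lt]
    rcases hX with ⟨hX18, -, h6, hX⟩ | ⟨hX18, b, hbS, hb, hb6, hb17, hmax⟩
    · exact Or.inl ⟨hX18, h5₃.frame hF, h6, hX⟩
    · exact Or.inr ⟨hX18, b, hbS, hb, hb6, fun a' ha' hlt => (hmax a' ha' hlt).trans hb17.le⟩

/-- Refine until the set is a clique. -/
def refineLoop : Prog := .seq (.const 18 1) (.loop (.eq 18 1) refineStep)

theorem runs_refineLoop (h : IsAdjacencyArray H off adj) {k ω p : ℕ} (hk : 0 < k)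
    (hH : CliqueDense H k) (hp : ∀ L, IsSemiLadder H L → L.length ≤ p) {T₀ : Finset (Fin n)}
    {σ : State} (hG : HasGraph n off adj σ) (hT₀ : HasSet σ 6 T₀)
    (hT₀off : T₀.card ≤ off n + 1) (hR : IsRefinement H k ω T₀ []) :
    Runs refineLoop σ ((p + 1) * (48 * ((min n (off n + 1) + 1) * (n + off n + 1)))) fun τ =>
      HasGraph n off adj τ ∧ ∃ S : Finset (Fin n), HasSet τ 5 S ∧ H.IsClique (S : Set (Fin n)) ∧
        ω ≤ k ^ 2 * refineLoss k p * S.card := by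
  set X := (min n (off n + 1) + 1) * (n + off n + 1) with hXdef
  have hX1 : 1 ≤ X := Nat.mul_pos (by omega) (by omega)
  refine Runs.mono (Runs.seq (Q := fun τ => τ = σ.setReg 18 1)
    (Runs.of_loopFree (p := .const 18 1) trivial rfl) fun τ hτ =>
    Runs.loop (B := 45 * X) (fun m τ => HasGraph n off adj τ ∧ ∃ S L, HasSet τ 6 S ∧
      S.card ≤ off n + 1 ∧ IsRefinement H k ω S L ∧
      ((τ.reg 18 = 1 ∧ m + L.length = p + 1) ∨ (τ.reg 18 = 0 ∧ m = 0 ∧ HasSet τ 5 S ∧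
        H.IsClique (S : Set (Fin n))))) ?_ ?_ (p + 1) ?_)
    (B := 1 + ((p + 1) * (45 * X + 1) + 1)) ?_ fun _ h => h
  · rintro m τ ⟨hG, S, L, hS, hSoff, hRef, hm⟩ hc
    simp only [Cond.holds_eq, hG.one] at hc
    rcases hm with ⟨-, hm⟩ | ⟨h0, -⟩
    swap
    · omega
    have hlen := hp L hRef.ladder
    have hSn : S.card ≤ n := by simpa using Finset.card_le_univ S
    have htime : 45 * ((S.card + 1) * (n + off n + 1)) ≤ 45 * X := by
      rw [hXdef]; gcongr; exact le_min hSn hSoff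
    by_cases hfull : ∀ a ∈ S, ¬ ∃ b ∈ S, ¬ (a = b ∨ H.Adj a b)
    · refine ⟨0, by omega, (runs_refineStep h hG hS).mono htime ?_⟩
      rintro υ ⟨hGυ, ⟨h18, h5, h6, -⟩ | ⟨-, a, ha, hb, -⟩⟩
      · refine ⟨hGυ, S, L, h6, hSoff, hRef, Or.inr ⟨h18, rfl, h5, ?_⟩⟩
        intro x hx y hy hxy
        by_contra hno
        exact hfull x hx ⟨y, hy, by tauto⟩
      · exact (hfull a ha hb).elim
    · refine ⟨m - 1, by omega, (runs_refineStep h hG hS).mono htime ?_⟩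
      rintro υ ⟨hGυ, ⟨-, -, -, hall⟩ | ⟨h18, a, ha, ⟨b, hb, hab⟩, h6, hmax⟩⟩
      · exact (hfull hall).elim
      · have hRef' := hRef.step hk hH ha hb hab hmax
        refine ⟨hGυ, nbrIn H S a, (a, b) :: L, h6,
          (Finset.card_le_card nbrIn_subset).trans hSoff, hRef', Or.inl ⟨h18, ?_⟩⟩
        simp only [List.length_cons]
        omega
  · rintro m τ ⟨hG, S, L, hS, hSoff, hRef, hm⟩ hc
    simp only [Cond.holds_eq, hG.one] at hc
    obtain ⟨-, -, h5, hclique⟩ := hm.resolve_left fun h => hc h.1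
    exact ⟨hG, S, h5, hclique, hRef.le_card hk (hp L hRef.ladder)⟩
  · subst hτ
    have hF : Frame [18] [] σ (σ.setReg 18 1) := (Frame.refl _ _ _).setReg (by simp)
    exact ⟨hG.frame hF, T₀, [], hT₀, hT₀off, hR, Or.inl ⟨by simp, by simp⟩⟩
  · have h1 : (p + 1) * (45 * X + 1) + (p + 1) * 2 ≤ (p + 1) * (48 * X) := by
      rw [← Nat.mul_add]
      exact Nat.mul_le_mul_left _ (by omega)
    omega

end RAM

namespace RAM

variable {n : ℕ} {H : SimpleGraph (Fin n)} {off adj : ℕ → ℕ}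

/-! ### Initialization and output -/

/-- Mark in bank `3` the vertices that have neighbours. -/
def markNonisolated : Prog :=
  forVerts 20 (.seq (.seq (.load 21 0 20) (.seq (.copy 22 20) (.seq (.inc 22) (.load 22 0 22))))
    (.ite (.lt 21 22) (.store 3 20 1) .skip))

theorem runs_markNonisolated {σ : State} (hG : HasGraph n off adj σ)
    (h3 : ∀ v, σ.mem 3 v = 0) :
    Runs markNonisolated σ (9 * n + 2) fun τ => Frame [20, 21, 22] [3] σ τ ∧
      HasSet τ 3 (Finset.univ.filter fun v : Fin n => off v < off (v + 1)) := by
  refine Runs.mono (runs_forVerts (fun k τ => Frame [20, 21, 22] [3] σ τ ∧ ∀ v,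
    τ.mem 3 v = if v < k ∧ off v < off (v + 1) then 1 else 0) (fun _ => 7) ?_
    (fun k τ hτ => (hG.frame hτ.1).size) (fun τ hτ => ⟨hτ.1, fun v => by simp [hτ.2]⟩)
    ⟨(Frame.refl _ _ _).setReg (by simp), by simp [h3]⟩) (by simp; omega) fun _ h => h
  rintro k hk τ ⟨hF, hτ⟩ h20
  have hGτ := hG.frame hF
  refine Runs.of_loopFree (p := .seq (.seq (.load 21 0 20) (.seq (.copy 22 20)
    (.seq (.inc 22) (.load 22 0 22)))) (.ite (.lt 21 22) (.store 3 20 1) .skip))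
    (by simp [Prog.LoopFree]) ?_
  have hF' : Frame [20, 21, 22] [3] σ ((((τ.setReg 21 (off k)).setReg 22 k).setReg 22
      (k + 1)).setReg 22 (off (k + 1))) :=
    (((hF.setReg (by simp)).setReg (by simp)).setReg (by simp)).setReg (by simp)
  have hrun : Prog.run (.seq (.load 21 0 20) (.seq (.copy 22 20)
      (.seq (.inc 22) (.load 22 0 22)))) τ = (((τ.setReg 21 (off k)).setReg 22 k).setReg 22
      (k + 1)).setReg 22 (off (k + 1)) := by
    simp [Prog.run, h20, hGτ.off]
  rw [Prog.run, hrun, Prog.run]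
  by_cases hlt : off k < off (k + 1)
  · rw [if_pos (by simpa using hlt)]
    refine ⟨by simp [Prog.run, h20], (hF'.setMem (by simp)).setReg (by simp), fun v => ?_⟩
    by_cases hv : v = k
    · subst hv; simp [Prog.run, h20, hlt, hGτ.one]
    · have : v < k + 1 ↔ v < k := by omega
      simp [Prog.run, h20, hv, hτ v, this]
  · rw [if_neg (by simpa using hlt)]
    refine ⟨by simp [Prog.run, h20], hF'.setReg (by simp), fun v => ?_⟩
    by_cases hv : v = k
    · subst hv; simp [Prog.run, hlt, hτ v]
    · have : v < k + 1 ↔ v < k := by omega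
      simp [Prog.run, hτ v, this]

/-- Initialize the constants, the set of vertices to be peeled, and a singleton. -/
def prepare : Prog :=
  .seq (.const 1 1) (.seq markNonisolated (.seq (.store 6 2 1) (.const 17 1)))

/-- List the members of the set in bank `5`. -/
def outputSet : Prog :=
  .seq (.const 19 0) (.seq (forMembers 5 20 (.seq (.store 2 19 20) (.inc 19))) (.copy 0 19))

theorem runs_outputSet {S : Finset (Fin n)} {σ : State} (hG : HasGraph n off adj σ)
    (hS : HasSet σ 5 S) :
    Runs outputSet σ (10 * (n + 1)) fun τ => OutputsVertexSet τ S := by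
  have hSn : S.card ≤ n := by simpa using Finset.card_le_univ S
  refine Runs.mono (Runs.seq (Q := fun τ => τ = σ.setReg 19 0)
    (Runs.of_loopFree (p := .const 19 0) trivial rfl) fun τ hτ =>
    Runs.seq (runs_forMembers S (fun X τ => Frame [13, 19, 20] [2] σ τ ∧
      (((List.range (τ.reg 19)).map (τ.mem 2) : List ℕ) : Multiset ℕ) = X.val.map Fin.val)
      (fun _ => 2) (by simp) ?_ ?_ ?_ (fun τ hτ => hτ) ?_ (2 * n + 5 * n + 2) ?_) ?_)
    (B := 1 + ((2 * n + 5 * n + 2) + 1)) (by omega) fun _ h => h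
  · rintro a ha - τ ⟨hF, hl⟩ h20
    refine Runs.of_loopFree (p := .seq (.store 2 19 20) (.inc 19)) (by simp [Prog.LoopFree]) ?_
    refine ⟨by simp [Prog.run, h20], (hF.setMem (by simp)).setReg (by simp), ?_⟩
    have h1 : (List.range (τ.reg 19)).map (Function.update (τ.mem 2) (τ.reg 19) (a : ℕ)) =
        (List.range (τ.reg 19)).map (τ.mem 2) := by
      refine List.map_congr_left fun x hx => ?_
      have := List.mem_range.mp hx
      exact Function.update_of_ne (by omega) _ _
    simp only [Prog.run, State.setReg_reg, State.setMem_reg, if_true, State.setReg_mem,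
      State.setMem_mem, h20, List.range_succ, List.map_append, h1]
    rw [← Multiset.coe_add, hl, Finset.cons_val, Multiset.map_cons]
    simp [add_comm]
  · rintro X τ ⟨hF, -⟩
    exact ⟨(hG.frame hF).size, (hG.frame hF).one, hS.frame hF⟩
  · rintro X τ x ⟨hF, hX⟩
    exact ⟨⟨hF.setReg (by simp), by simpa using hX⟩, ⟨hF.setReg (by simp), by simpa using hX⟩⟩
  · subst hτ
    exact ⟨(Frame.refl _ _ _).setReg (by simp), by simp⟩
  · simp; omega
  · rintro τ ⟨-, hl⟩
    refine Runs.of_loopFree (p := .copy 0 19) trivial ?_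
    simpa [OutputsVertexSet, Prog.run] using hl

/-- The approximation algorithm for the maximum clique. -/
def approxClique : Prog :=
  .seq prepare (.seq peel (.seq refineLoop outputSet))

theorem runs_approxClique {k p : ℕ} (hk : 0 < k) (hH : CliqueDense H k)
    (hp : ∀ L, IsSemiLadder H L → L.length ≤ p) {nbr : Fin n → List (Fin n)}
    (hnbr : IsAdjacencyList H nbr) :
    Runs approxClique (graphInput nbr)
      ((760 + 480 * (p + 1)) * (max n 1 * max H.edgeSet.ncard 1)) fun τ =>
      ∃ K : Finset (Fin n), OutputsVertexSet τ K ∧ H.IsClique (K : Set (Fin n)) ∧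
        H.cliqueNum ≤ k ^ 2 * refineLoss k p * K.card := by
  classical
  have h := isAdjacencyArray_graphInput hnbr
  set off := (graphInput nbr).mem 0
  set adj := (graphInput nbr).mem 1
  set m := H.edgeSet.ncard
  have hoff : off n = 2 * m := h.off_last
  set ω := H.cliqueNum
  have hω : ∀ Q : Finset (Fin n), H.IsClique (Q : Set (Fin n)) → Q.card ≤ ω := fun Q hQ =>
    hQ.card_le_cliqueNum
  set A₀ := Finset.univ.filter fun v : Fin n => off v < off (v + 1) with hA₀
  set T₀ := Finset.univ.filter fun v : Fin n => v.val = 0 with hT₀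
  have hA₀n : A₀.card ≤ n := by simpa using Finset.card_le_univ A₀
  have hA₀off : A₀.card ≤ off n := by
    calc A₀.card = ∑ v ∈ A₀, 1 := by simp
      _ ≤ ∑ v ∈ A₀, (1 * (off (v + 1) - off v) + 0) := Finset.sum_le_sum fun v hv => by
          have := (Finset.mem_filter.mp hv).2
          omega
      _ ≤ off n := by simpa using h.sum_degree_le A₀ 1 0
  have hT₀card : T₀.card ≤ 1 := Finset.card_le_one.mpr fun x hx y hy => by
    rw [hT₀, Finset.mem_filter] at hx hy
    exact Fin.ext (hx.2.trans hy.2.symm)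
  have hT₀mem : ∀ hn : 0 < n, (⟨0, hn⟩ : Fin n) ∈ T₀ := fun hn => by simp [hT₀]
  have hω1 : 0 < n → 1 ≤ ω := fun hn => by
    simpa using hω {⟨0, hn⟩} (by simp)
  have hT₀ω : T₀.card ≤ k * ω := by
    rcases Nat.eq_zero_or_pos n with h0 | h0
    · subst h0
      rw [Finset.eq_empty_of_isEmpty T₀]; simp
    · exact hT₀card.trans (Nat.mul_pos hk (hω1 h0))
  have hbound : ∀ x, x ≤ n → x ≤ off n + 1 →
      (x + 1) * (n + off n + 1) ≤ 10 * (max n 1 * max m 1) := by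
    intro x hx hx'
    have h1 : x * n ≤ (2 * m + 1) * n := Nat.mul_le_mul_right _ (by omega)
    have h2 : x * (2 * m) ≤ n * (2 * m) := Nat.mul_le_mul_right _ hx
    have h3 : n * m ≤ max n 1 * max m 1 := Nat.mul_le_mul (le_max_left _ _) (le_max_left _ _)
    have h4 : n * 1 ≤ max n 1 * max m 1 := Nat.mul_le_mul (le_max_left _ _) (le_max_right _ _)
    have h5 : 1 * m ≤ max n 1 * max m 1 := Nat.mul_le_mul (le_max_right _ _) (le_max_left _ _)
    have h6 : 1 * 1 ≤ max n 1 * max m 1 := Nat.mul_le_mul (le_max_right _ _) (le_max_right _ _)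
    rw [hoff]
    nlinarith
  have hn1 : n + 1 ≤ 2 * (max n 1 * max m 1) := by
    have h4 : n * 1 ≤ max n 1 * max m 1 := Nat.mul_le_mul (le_max_left _ _) (le_max_right _ _)
    have h6 : 1 * 1 ≤ max n 1 * max m 1 := Nat.mul_le_mul (le_max_right _ _) (le_max_right _ _)
    omega
  have htime₁ := hbound A₀.card hA₀n (by omega)
  have htime₂ := hbound (min n (off n + 1)) (min_le_left _ _) (min_le_right _ _)
  set Y := max n 1 * max m 1
  refine Runs.mono (B := (1 + (9 * n + 2 + (1 + 1))) +
    (65 * ((A₀.card + 1) * (n + off n + 1)) +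
    ((p + 1) * (48 * ((min n (off n + 1) + 1) * (n + off n + 1))) + 10 * (n + 1))))
    (Runs.seq (Q := fun τ => HasGraph n off adj τ ∧ HasSet τ 3 A₀ ∧ HasSet τ 6 T₀ ∧ τ.reg 17 = 1)
      (Runs.seq (Q := fun τ => τ = (graphInput nbr).setReg 1 1)
        (Runs.of_loopFree (p := .const 1 1) trivial rfl) ?_) ?_) ?_ fun _ h => h
  · rintro τ rfl
    have hG : HasGraph n off adj ((graphInput nbr).setReg 1 1) :=
      ⟨by simp [graphInput], by simp, by simp [graphInput], rfl, rfl⟩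
    refine Runs.seq (runs_markNonisolated hG (by simp [graphInput])) ?_
    rintro τ ⟨hF, h3⟩
    have hGτ := hG.frame hF
    refine Runs.seq (Q := fun υ => υ = τ.setMem 6 0 1)
      (Runs.of_loopFree (p := .store 6 2 1) trivial
        (by simp [Prog.run, hGτ.zero, hGτ.one])) fun υ hυ => ?_
    subst hυ
    refine Runs.of_loopFree (p := .const 17 1) trivial ?_
    have hF' : Frame [17] [6] τ ((τ.setMem 6 0 1).setReg 17 1) :=
      ((Frame.refl _ _ _).setMem (by simp)).setReg (by simp)
    refine ⟨hGτ.frame hF', h3.frame hF', fun v => ?_, by simp [Prog.run]⟩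
    have h6 := congrFun (hF.mem 6 (by simp)) v
    by_cases hv : v.val = 0
    · simp [Prog.run, hT₀, hv]
    · simp [Prog.run, hT₀, hv, h6, graphInput]
  · rintro τ ⟨hG, h3, h6, h17⟩
    refine Runs.seq (runs_peel h hH hω hG h3 h6 h17 hT₀ω (by omega) ?_) ?_
    · rcases Nat.eq_zero_or_pos n with h0 | h0
      · exact Or.inl h0
      · exact Or.inr (pairCount_pos (hT₀mem h0))
    rintro υ ⟨hGυ, T, hT, hTω, hToff, hT1, hTQ⟩
    have hRef : IsRefinement H k ω T [] := by
      refine ⟨⟨List.Pairwise.nil, by simp⟩, by simp, hTω, Or.inr ?_⟩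
      simp only [List.length_nil, refineLoss, one_mul]
      obtain ⟨Q, hQ⟩ := H.exists_isNClique_cliqueNum
      have hQcard : Q.card = ω := hQ.card_eq
      rcases Nat.lt_or_ge ω 2 with hlt | hge
      · rcases hT1 with h0 | h1
        · have : ω = 0 := by
            rw [← hQcard]; subst h0; rw [Finset.eq_empty_of_isEmpty Q]; simp
          simp [this]
        · have : ω * ω ≤ 1 * 1 := Nat.mul_le_mul (by omega) (by omega)
          omega
      · rw [← hQcard]
        refine hTQ Q ?_ hQ.isClique (Finset.card_pos.mp (by omega))
        intro x hx
        obtain ⟨y, hy, hyx⟩ := Finset.exists_mem_ne (by omega : 1 < Q.card) x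
        obtain ⟨i, hi, -⟩ := (h.adj_iff x y).mp (hQ.isClique hx hy hyx.symm)
        rw [Finset.mem_Ico] at hi
        simp only [hA₀, Finset.mem_filter, Finset.mem_univ, true_and]
        omega
    refine Runs.seq (runs_refineLoop h hk hH hp hGυ hT hToff hRef) ?_
    rintro ρ ⟨hGρ, S, h5, hS, hSω⟩
    exact (runs_outputSet hGρ h5).mono le_rfl fun τ' hτ' => ⟨S, hτ', hS, hSω⟩
  · have h1 : (p + 1) * (48 * ((min n (off n + 1) + 1) * (n + off n + 1))) ≤
        (p + 1) * (48 * (10 * Y)) := by gcongr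
    have h2 : (p + 1) * (48 * (10 * Y)) = 480 * (p + 1) * Y := by ring
    have h3 : (760 + 480 * (p + 1)) * Y = 760 * Y + 480 * (p + 1) * Y := by ring
    omega

end RAM

theorem mainTheorem7 (C : Set FinGraph.{u}) (hC : BoundedExpansion C) (d : ℕ) :
    ∃ s : ℕ, 0 < s ∧ ∃ (P : RAM.Prog) (c : ℕ),
      ∀ (n : ℕ) (H : SimpleGraph (Fin n)), InHereditaryClosure (powerClass C d) H →
        ∀ nbr : Fin n → List (Fin n), IsAdjacencyList H nbr →
          ∃ (t : ℕ) (τ : RAM.State) (K : Finset (Fin n)),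
            RAM.Exec P (graphInput nbr) t τ ∧
            t ≤ c * (max n 1 * max H.edgeSet.ncard 1) ∧
            OutputsVertexSet τ K ∧
            H.IsClique (K : Set (Fin n)) ∧
            (1 / (s : ℝ)) * (H.cliqueNum : ℝ) ≤ (K.card : ℝ) := by
  obtain ⟨k, p, hk, hbounds⟩ := hC.exists_bounds.{u, 0} d
  have hs : 0 < k ^ 2 * refineLoss k p := Nat.mul_pos (pow_pos hk 2) (refineLoss_pos hk p)
  refine ⟨k ^ 2 * refineLoss k p, hs, RAM.approxClique, 760 + 480 * (p + 1), ?_⟩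
  intro n H hH nbr hnbr
  obtain ⟨hdense, hladder⟩ := hbounds _ H hH
  obtain ⟨t, τ, hexec, ht, K, hout, hK, hcard⟩ := RAM.runs_approxClique hk hdense hladder hnbr
  refine ⟨t, τ, K, hexec, ht, hout, hK, ?_⟩
  rw [one_div, inv_mul_le_iff₀ (by exact_mod_cast hs)]
  exact_mod_cast hcard
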